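/- Setting. Let $\mathbf E_1,\mathbf E_2,\mathbf E_3$ be a left-invariant frame with $[\mathbf E_b,\mathbf E_c]=C^d_{bc}\mathbf E_d$, where $C^d_{bc}=a_b\delta^d_c-a_c\delta^d_b$ and $(a_1,a_2,a_3)=(1,0,0)$ (Bianchi type V), and let $\mathbf W^a$ be the dual frame. A $C^\infty$ solution on $[t_0,\infty)$ of the Einstein–Vlasov system with Bianchi V symmetry consists of a spacetime metric $-dt^2+g_{ab}(t)\mathbf W^a\mathbf W^b$ with $g_{ab}(t)$ positive definite, a second fundamental form $k_{ab}(t)$, and a distribution function $f=f(t,p_1,p_2,p_3)\ge 0$ of particles of unit mass, all $C^\infty$ up to $t=t_0$, with $f(t,\cdot)$ compactly supported for each $t$, such that for all $t\ge t_0$ $$\dot g_{ab}=-2k_{ab},\qquad \dot k_{ab}=R_{ab}+k\,k_{ab}-2k_{ac}k^c_b-8\pi\bigl(S_{ab}-\tfrac12 g_{ab}S\bigr)-4\pi\rho\, g_{ab},$$ $$R-k_{ab}k^{ab}+k^2=16\pi\rho,\qquad \nabla^a k_{ab}=8\pi j_b,\qquad \frac{\partial f}{\partial t}+(p^0)^{-1}C^d_{ba}p^bp_d\frac{\partial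 f}{\partial p_a}=0 .$$ Here $R_{ab}$, $R$, $\nabla$ are the Ricci tensor, the scalar curvature and the Levi-Civita connection of $g_{ab}(t)\mathbf W^a\mathbf W^b$; $k=g^{ab}k_{ab}$; $p^a=g^{ab}p_b$; $p^0=(1+g^{ab}p_ap_b)^{1/2}$; $$\rho=\int f\,p^0\sqrt{\det g}\;dp^1dp^2dp^3,\quad j_a=\int f\,p_a\sqrt{\det g}\;dp^1dp^2dp^3,\quad S_{ab}=\int f\,\frac{p_ap_b}{p^0}\sqrt{\det g}\;dp^1dp^2dp^3,$$ and $S=g^{ab}S_{ab}$. It is assumed that $k<0$ for all $t\ge t_0$ and that the origin of time is chosen so that $t_0=-3/k(t_0)$. Put $H=-k/3$, $\Sigma^a_b=(k^a_b+H\delta^a_b)/H$, $\Sigma_+=-\frac12(\Sigma^2_2+\Sigma^3_3)$, $\Sigma_-=-\frac1{2\sqrt3}(\Sigma^2_2-\Sigma^3_3)$, $A=-R/(6H^2)$ and $\mathrm P(t)=\sup\{(g^{ab}p_ap_b)^{1/2} : f(t,p)\ne0\}$ (with $\mathrm P(t)=0$ if $f(t,\cdot)=0$). A characteristic of the Vlasov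 equation is a solution $V=(V_1,V_2,V_3)$ on $[t_0,\infty)$ of $$\frac{dV_a}{dt}=(V^0)^{-1}C^d_{ba}V^bV_d,\qquad V^b=g^{bc}V_c,\quad V^0=(1+g^{bc}V_bV_c)^{1/2}.$$ Statement. There is a $\delta>0$ such that for every such solution with $|\Sigma_+(t_0)|$, $|\Sigma_-(t_0)|$, $|\Sigma^i_j(t_0)|$ (for all $i\ne j$), $|A(t_0)-1|$ and $\mathrm P(t_0)$ all less than $\delta$, the following hold. 1. For every $r$ there are constants $C$ and $M$ such that every characteristic $V$ with $|V_i(t_0)|\le r$ for $i=1,2,3$ satisfies $$|V_i(t)|\le C+M\,t^{-1}\qquad\text{for all } t\ge t_0,\ i=1,2,3;$$ that is, $|V_i|\le C+O(t^{-1})$, uniformly over characteristics with bounded initial momenta. 2. Consequently there is a constant $C$ such that for all $t\ge t_0$, $f(t,p)=0$ whenever $|p_i|\ge C$ for some $i$. -/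

import Mathlib

open scoped ContDiff Matrix

noncomputable section

namespace BianchiV

/-! Frame indices `1, 2, 3` are `0, 1, 2 : Fin 3`. Structure constants `C^d_{bc}` of a frame
`E_1, E_2, E_3` with `[E_b, E_c] = C^d_{bc} E_d` are written `C d b c`. -/

/-- The Bianchi V structure constants `C^d_{bc} = a_b δ^d_c - a_c δ^d_b` with `a = (1, 0, 0)`. -/
def structConst (d b c : Fin 3) : ℝ :=
  (if b = 0 ∧ d = c then 1 else 0) - (if c = 0 ∧ d = b then 1 else 0)

/-- `Γ_{abc} = g(E_a, ∇_{E_c} E_b)` for the Levi-Civita connection of a metric whose components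
`g_{ab}` in the frame are spatially constant (Koszul formula). -/
def connLower (C : Fin 3 → Fin 3 → Fin 3 → ℝ) (g : Matrix (Fin 3) (Fin 3) ℝ)
    (a b c : Fin 3) : ℝ :=
  (1 / 2) * ∑ d, (C d c b * g a d + C d a c * g b d - C d b a * g c d)

/-- `Γ^a_{bc}`, so that `∇_{E_c} E_b = Γ^a_{bc} E_a`. -/
def conn (C : Fin 3 → Fin 3 → Fin 3 → ℝ) (g : Matrix (Fin 3) (Fin 3) ℝ)
    (a b c : Fin 3) : ℝ :=
  ∑ d, g⁻¹ a d * connLower C g d b c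

/-- The Riemann tensor `R^a_{bcd}`, the `E_a`-component of
`∇_{E_c} ∇_{E_d} E_b - ∇_{E_d} ∇_{E_c} E_b - ∇_{[E_c, E_d]} E_b`. -/
def riemann (C : Fin 3 → Fin 3 → Fin 3 → ℝ) (g : Matrix (Fin 3) (Fin 3) ℝ)
    (a b c d : Fin 3) : ℝ :=
  ∑ m, (conn C g m b d * conn C g a m c - conn C g m b c * conn C g a m d
    - C m c d * conn C g a b m)

/-- The Ricci tensor `R_{bd} = R^a_{bad}`. -/
def ricci (C : Fin 3 → Fin 3 → Fin 3 → ℝ) (g : Matrix (Fin 3) (Fin 3) ℝ)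
    (b d : Fin 3) : ℝ :=
  ∑ a, riemann C g a b a d

/-- The scalar curvature `R = g^{ab} R_{ab}`. -/
def scalarCurv (C : Fin 3 → Fin 3 → Fin 3 → ℝ) (g : Matrix (Fin 3) (Fin 3) ℝ) : ℝ :=
  ∑ a, ∑ b, g⁻¹ a b * ricci C g a b

/-- `∇_c h_{ab}` for a covariant 2-tensor with spatially constant frame components. -/
def covDeriv (C : Fin 3 → Fin 3 → Fin 3 → ℝ) (g h : Matrix (Fin 3) (Fin 3) ℝ)
    (c a b : Fin 3) : ℝ :=
  -∑ m, (conn C g m a c * h m b + conn C g m b c * h a m)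

/-- The divergence `∇^a h_{ab}`. -/
def divergence (C : Fin 3 → Fin 3 → Fin 3 → ℝ) (g h : Matrix (Fin 3) (Fin 3) ℝ)
    (b : Fin 3) : ℝ :=
  ∑ a, ∑ c, g⁻¹ a c * covDeriv C g h c a b

/-- The `g`-trace `g^{ab} h_{ab}`. -/
def trg (g h : Matrix (Fin 3) (Fin 3) ℝ) : ℝ :=
  ∑ a, ∑ b, g⁻¹ a b * h a b

/-- `g^{ab} p_a p_b` for a covector `p`. -/
def normSq (g : Matrix (Fin 3) (Fin 3) ℝ) (p : Fin 3 → ℝ) : ℝ :=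
  ∑ a, ∑ b, g⁻¹ a b * p a * p b

/-- The contravariant components `p^a = g^{ab} p_b`. -/
def raise (g : Matrix (Fin 3) (Fin 3) ℝ) (p : Fin 3 → ℝ) (a : Fin 3) : ℝ :=
  ∑ b, g⁻¹ a b * p b

/-- `p^0` from the mass shell relation `-(p^0)² + g^{ab} p_a p_b = -1`, `p^0 > 0`. -/
def pZero (g : Matrix (Fin 3) (Fin 3) ℝ) (p : Fin 3 → ℝ) : ℝ :=
  √(1 + normSq g p)

/-! The energy-momentum tensor. The distribution function `f` at a fixed time is a function of the
covariant components `p_a`; the integrals run over the contravariant components `v = (p^a)`, with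
`p_a = g_{ab} p^b` and volume element `√(det g) dp^1 dp^2 dp^3`. -/

/-- The energy density `ρ = T^{00} = ∫ f p^0 √(det g) dp^1 dp^2 dp^3`. -/
def energyDensity (g : Matrix (Fin 3) (Fin 3) ℝ) (f : (Fin 3 → ℝ) → ℝ) : ℝ :=
  ∫ v : Fin 3 → ℝ, f (g *ᵥ v) * pZero g (g *ᵥ v) * √g.det

/-- The matter current `j_a = T_a^0 = -T_{0a} = ∫ f p_a √(det g) dp^1 dp^2 dp^3`. -/
def current (g : Matrix (Fin 3) (Fin 3) ℝ) (f : (Fin 3 → ℝ) → ℝ) (a : Fin 3) : ℝ :=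
  ∫ v : Fin 3 → ℝ, f (g *ᵥ v) * (g *ᵥ v) a * √g.det

/-- The stress tensor `S_{ab} = T_{ab} = ∫ f p_a p_b (p^0)⁻¹ √(det g) dp^1 dp^2 dp^3`. -/
def stress (g : Matrix (Fin 3) (Fin 3) ℝ) (f : (Fin 3 → ℝ) → ℝ) :
    Matrix (Fin 3) (Fin 3) ℝ :=
  fun a b => ∫ v : Fin 3 → ℝ,
    f (g *ᵥ v) * (g *ᵥ v) a * (g *ᵥ v) b * (pZero g (g *ᵥ v))⁻¹ * √g.det

/-- The momentum component `(p^0)⁻¹ C^d_{ba} p^b p_d` of the vector field on momentum space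
(in the covariant components) that drives the Vlasov equation. -/
def force (C : Fin 3 → Fin 3 → Fin 3 → ℝ) (g : Matrix (Fin 3) (Fin 3) ℝ)
    (p : Fin 3 → ℝ) (a : Fin 3) : ℝ :=
  (pZero g p)⁻¹ * ∑ b, ∑ d, C d b a * raise g p b * p d

/-- `(g, k, f)` is a smooth solution on `[t₀, ∞)` of the Einstein-Vlasov system with Bianchi V
symmetry, for particles of unit mass: `-dt² + g_{ab}(t) W^a W^b` is the spacetime metric, `k_{ab}`
the second fundamental form of the hypersurfaces of constant time, and `f(t, p_1, p_2, p_3)` the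
distribution function. The spacetime expands (`k < 0`), and the origin of time is such that
`t₀ = -3 / k(t₀)`. -/
structure IsSolution (t₀ : ℝ) (g k : ℝ → Matrix (Fin 3) (Fin 3) ℝ)
    (f : ℝ → (Fin 3 → ℝ) → ℝ) : Prop where
  smooth_g : ∀ a b, ContDiffOn ℝ ∞ (fun t => g t a b) (Set.Ici t₀)
  smooth_k : ∀ a b, ContDiffOn ℝ ∞ (fun t => k t a b) (Set.Ici t₀)
  smooth_f : ContDiffOn ℝ ∞ (fun x : ℝ × (Fin 3 → ℝ) => f x.1 x.2) (Set.Ici t₀ ×ˢ Set.univ)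
  posDef : ∀ t, t₀ ≤ t → (g t).PosDef
  f_nonneg : ∀ t, t₀ ≤ t → ∀ p, 0 ≤ f t p
  f_compact : ∀ t, t₀ ≤ t → HasCompactSupport (f t)
  expanding : ∀ t, t₀ ≤ t → trg (g t) (k t) < 0
  time_origin : t₀ = -3 / trg (g t₀) (k t₀)
  deriv_g : ∀ t, t₀ ≤ t → ∀ a b,
    HasDerivWithinAt (fun s => g s a b) (-2 * k t a b) (Set.Ici t₀) t
  deriv_k : ∀ t, t₀ ≤ t → ∀ a b,
    HasDerivWithinAt (fun s => k s a b)
      (ricci structConst (g t) a b + trg (g t) (k t) * k t a b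
        - 2 * ∑ c, ∑ d, k t a c * (g t)⁻¹ c d * k t d b
        - 8 * Real.pi * (stress (g t) (f t) a b
            - (1 / 2) * g t a b * trg (g t) (stress (g t) (f t)))
        - 4 * Real.pi * energyDensity (g t) (f t) * g t a b)
      (Set.Ici t₀) t
  hamiltonian : ∀ t, t₀ ≤ t →
    scalarCurv structConst (g t)
      - (∑ a, ∑ b, ∑ c, ∑ d, (g t)⁻¹ a c * (g t)⁻¹ b d * k t a b * k t c d)
      + trg (g t) (k t) ^ 2
    = 16 * Real.pi * energyDensity (g t) (f t)
  momentum : ∀ t, t₀ ≤ t → ∀ b,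
    divergence structConst (g t) (k t) b = 8 * Real.pi * current (g t) (f t) b
  vlasov : ∀ t, t₀ ≤ t → ∀ p,
    derivWithin (fun s => f s p) (Set.Ici t₀) t
      + ∑ a, force structConst (g t) p a * fderiv ℝ (f t) p (Pi.single a 1) = 0

/-- `V = (V_1, V_2, V_3)` is a characteristic on `[t₀, ∞)` of the Vlasov equation:
`dV_a/dt = (V^0)⁻¹ C^d_{ba} V^b V_d`. -/
def IsCharacteristic (t₀ : ℝ) (g : ℝ → Matrix (Fin 3) (Fin 3) ℝ)
    (V : ℝ → Fin 3 → ℝ) : Prop :=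
  ∀ t, t₀ ≤ t → ∀ a,
    HasDerivWithinAt (fun s => V s a) (force structConst (g t) (V t) a) (Set.Ici t₀) t

/-- The Hubble parameter `H = -k/3`. -/
def hubble (g k : Matrix (Fin 3) (Fin 3) ℝ) : ℝ := -(1 / 3) * trg g k

/-- The trace-free part `σ_{ab} = k_{ab} + H g_{ab}` of the second fundamental form. -/
def shear (g k : Matrix (Fin 3) (Fin 3) ℝ) : Matrix (Fin 3) (Fin 3) ℝ :=
  k + hubble g k • g

/-- `Σ^a_b = σ^a_b / H`. -/
def shearNormalized (g k : Matrix (Fin 3) (Fin 3) ℝ) (a b : Fin 3) : ℝ :=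
  (∑ c, g⁻¹ a c * shear g k c b) / hubble g k

/-- `Σ_+ = -(Σ^2_2 + Σ^3_3) / 2`. -/
def shearPlus (g k : Matrix (Fin 3) (Fin 3) ℝ) : ℝ :=
  -(1 / 2) * (shearNormalized g k 1 1 + shearNormalized g k 2 2)

/-- `Σ_- = -(Σ^2_2 - Σ^3_3) / (2√3)`. -/
def shearMinus (g k : Matrix (Fin 3) (Fin 3) ℝ) : ℝ :=
  -(1 / (2 * √3)) * (shearNormalized g k 1 1 - shearNormalized g k 2 2)

/-- `A = -R / (6 H²)`. -/
def curvA (g k : Matrix (Fin 3) (Fin 3) ℝ) : ℝ :=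
  -scalarCurv structConst g / (6 * hubble g k ^ 2)

/-- `P = sup {|p| = (g^{ab} p_a p_b)^{1/2} : f(p) ≠ 0}`; it is `0` in the absence of particles. -/
def maxMomentum (g : Matrix (Fin 3) (Fin 3) ℝ) (f : (Fin 3 → ℝ) → ℝ) : ℝ :=
  sSup ((fun p => √(normSq g p)) '' {p | f p ≠ 0})

/-- The initial data at one time are `δ`-close to those of the Milne solution. -/
structure SmallData (δ : ℝ) (g k : Matrix (Fin 3) (Fin 3) ℝ) (f : (Fin 3 → ℝ) → ℝ) : Prop where
  plus : |shearPlus g k| < δ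
  minus : |shearMinus g k| < δ
  offDiag : ∀ i j, i ≠ j → |shearNormalized g k i j| < δ
  curv : |curvA g k - 1| < δ
  momentum : maxMomentum g f < δ

end BianchiV

end

namespace BianchiV

/-! Every left-invariant metric on the Bianchi V group has constant sectional curvature `-g⁻¹ 0 0`.
The Ricci tensor is thus pure trace, so the trace-free part of `k` is driven by matter alone, and `A
= g⁻¹ 0 0 / H²`.

Write `Ω = 8πρ / (3H²)`; by the Hamiltonian constraint `Ω = 1 - A - |Σ|² / 6`. The function `L =
|Σ|² + 7 Ω²` measures the distance to the Milne solution. While `L ≤ 1/16` and all particle momenta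
have length at most `1/100`, `L` is nonincreasing: the matter terms are controlled by `|σ^{ab}
S_{ab}| ≤ |σ| tr S` and `tr S ≤ ρ`, and the momentum constraint bounds the only other source, the
component of the shear along the distinguished frame direction, by the current
(`lyapunov_rate_nonpos`, `exists_hasDerivWithinAt_lyapunov`). Conversely `L ≤ 1/16` gives `|Σ| ≤
1/4`, so expansion wins over shear and lengths of momenta decrease along characteristics. Since `f`
is constant along characteristics, the two bounds sustain each other, and a continuity argument
(`IsSolution.milneDist_le`) gives `L ≤ 1/16` for all time.

No decay rates are then needed for the components `V_a`. The logarithmic growth rate of `1 + V_a²`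
is at most `2 (|V|² + g⁻¹ 0 0)`, and `W = (|V|² + g⁻¹ 0 0) / H` decreases at least at the rate
`(3/8)(|V|² + g⁻¹ 0 0)`. Hence `(1 + V_a²) exp (6 W)` is nonincreasing, which bounds `V_a` by its
initial data (`IsSolution.one_add_sq_le`). For the support of `f`, characteristics are solved
backward from any point where `f` is nonzero. -/

abbrev Mat : Type := Matrix (Fin 3) (Fin 3) ℝ

/-! ### Curvature and divergence for Bianchi V metrics -/

lemma conn_structConst {g : Mat} (hs : g.IsSymm) (hG : g⁻¹ * g = 1) (a b c : Fin 3) :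
    conn structConst g a b c
      = g⁻¹ a 0 * g b c - (if b = 0 then 1 else 0) * (if a = c then 1 else 0) := by
  have hl : ∀ d, connLower structConst g d b c
      = (if d = 0 then 1 else 0) * g b c - (if b = 0 then 1 else 0) * g d c := by
    intro d
    have h1 := hs.apply 0 1
    have h2 := hs.apply 0 2
    have h3 := hs.apply 1 2
    fin_cases d <;> fin_cases b <;> fin_cases c <;>
      simp [connLower, structConst, Fin.sum_univ_three, h1, h2, h3] <;> ring
  have h := congrFun (congrFun hG a) c
  simp only [Matrix.mul_apply, Matrix.one_apply] at h
  simp only [conn, hl, mul_sub, Finset.sum_sub_distrib]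
  rw [← h, Finset.mul_sum]
  congr 1
  · simp
  · exact Finset.sum_congr rfl fun d _ => by ring

lemma sum_conn_mul {g : Mat} (hs : g.IsSymm) (hG : g⁻¹ * g = 1) (h : Fin 3 → ℝ) (b c : Fin 3) :
    ∑ m, conn structConst g m b c * h m
      = g b c * (∑ m, g⁻¹ 0 m * h m) - (if b = 0 then 1 else 0) * h c := by
  have hi : g⁻¹.IsSymm := hs.inv
  simp only [conn_structConst hs hG, sub_mul, Finset.sum_sub_distrib, Finset.mul_sum]
  congr 1
  · exact Finset.sum_congr rfl fun m _ => by rw [hi.apply 0 m]; ring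
  · simp

lemma ricci_structConst {g : Mat} (hs : g.IsSymm) (hG : g⁻¹ * g = 1) (b d : Fin 3) :
    ricci structConst g b d = -2 * g⁻¹ 0 0 * g b d := by
  have hi : g⁻¹.IsSymm := hs.inv
  have hr : ∀ a c, ∑ m, g⁻¹ a m * g m c = if a = c then 1 else 0 := by
    intro a c
    have h := congrFun (congrFun hG a) c
    simpa only [Matrix.mul_apply, Matrix.one_apply] using h
  -- Constant curvature `-g⁻¹ 0 0`, read off before summing over `a`.
  have hkey : ∀ a, riemann structConst g a b a d
      = -g⁻¹ 0 0 * (g b d - (if a = d then 1 else 0) * g b a) := by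
    intro a
    have e1 := sum_conn_mul hs hG (fun m => conn structConst g a m a) b d
    have e2 := sum_conn_mul hs hG (fun m => conn structConst g a m d) b a
    simp only [riemann, Finset.sum_sub_distrib]
    rw [e1, e2]
    simp only [conn_structConst hs hG, mul_sub, Finset.sum_sub_distrib]
    have e3 : ∀ c, ∑ m, g⁻¹ 0 m * (g⁻¹ a 0 * g m c) = g⁻¹ a 0 * (if 0 = c then 1 else 0) := by
      intro c
      rw [← hr 0 c, Finset.mul_sum]
      exact Finset.sum_congr rfl fun m _ => by ring
    simp only [e3]
    have h1 := hs.apply 0 1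
    have h2 := hs.apply 0 2
    have h3 := hs.apply 1 2
    fin_cases a <;> fin_cases b <;> fin_cases d <;>
      simp [structConst, h1, h2, h3] <;> ring
  simp only [ricci, hkey]
  fin_cases b <;> fin_cases d <;> simp [Fin.sum_univ_three] <;> ring

lemma trg_eq_trace {g h : Mat} (hs : h.IsSymm) : trg g h = (g⁻¹ * h).trace := by
  simp only [trg, Matrix.trace, Matrix.diag, Matrix.mul_apply]
  exact Finset.sum_congr rfl fun a _ => Finset.sum_congr rfl fun b _ => by rw [hs.apply]

lemma trg_self {g : Mat} (hs : g.IsSymm) (hG : g⁻¹ * g = 1) : trg g g = 3 := by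
  rw [trg_eq_trace hs, hG]; simp

lemma scalarCurv_structConst {g : Mat} (hs : g.IsSymm) (hG : g⁻¹ * g = 1) :
    scalarCurv structConst g = -6 * g⁻¹ 0 0 := by
  have h := trg_self hs hG
  simp only [trg] at h
  simp only [scalarCurv, ricci_structConst hs hG]
  have : ∀ a b, g⁻¹ a b * (-2 * g⁻¹ 0 0 * g a b) = (-2 * g⁻¹ 0 0) * (g⁻¹ a b * g a b) := by
    intros; ring
  simp only [this, ← Finset.mul_sum, h]
  ring

lemma covDeriv_structConst {g h : Mat} (hs : g.IsSymm) (hG : g⁻¹ * g = 1) (hh : h.IsSymm)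
    (c a b : Fin 3) :
    covDeriv structConst g h c a b
      = -(g a c * (g⁻¹ * h) 0 b - (if a = 0 then 1 else 0) * h c b
        + (g b c * (g⁻¹ * h) 0 a - (if b = 0 then 1 else 0) * h a c)) := by
  have e1 := sum_conn_mul hs hG (fun m => h m b) a c
  have e2 := sum_conn_mul hs hG (fun m => h a m) b c
  simp only [covDeriv, Finset.sum_add_distrib, e1, e2, Matrix.mul_apply]
  simp only [fun m => hh.apply a m]

lemma divergence_structConst {g h : Mat} (hs : g.IsSymm) (hG : g⁻¹ * g = 1) (hh : h.IsSymm)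
    (b : Fin 3) :
    divergence structConst g h b
      = -(3 * (g⁻¹ * h) 0 b - (if b = 0 then 1 else 0) * trg g h) := by
  have hi : g⁻¹.IsSymm := hs.inv
  have hr : ∀ a c, ∑ m, g⁻¹ a m * g m c = if a = c then 1 else 0 := by
    intro a c
    have h := congrFun (congrFun hG a) c
    simpa only [Matrix.mul_apply, Matrix.one_apply] using h
  have h3 := trg_self hs hG
  simp only [divergence, covDeriv_structConst hs hG hh]
  have e1 : ∑ a, ∑ c, g⁻¹ a c * (g a c * (g⁻¹ * h) 0 b) = 3 * (g⁻¹ * h) 0 b := by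
    rw [← h3, trg]; simp only [Finset.sum_mul, mul_assoc]
  have e2 : ∑ a, ∑ c, g⁻¹ a c * ((if a = 0 then 1 else 0) * h c b) = (g⁻¹ * h) 0 b := by
    simp [Fin.sum_univ_three, Matrix.mul_apply]
  have e3 : ∑ a, ∑ c, g⁻¹ a c * (g b c * (g⁻¹ * h) 0 a) = (g⁻¹ * h) 0 b := by
    have : ∀ a, ∑ c, g⁻¹ a c * (g b c * (g⁻¹ * h) 0 a)
        = (if a = b then 1 else 0) * (g⁻¹ * h) 0 a := by
      intro a
      rw [← hr a b, Finset.sum_mul]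
      exact Finset.sum_congr rfl fun c _ => by rw [hs.apply c b]; ring
    simp [this]
  have e4 : ∑ a, ∑ c, g⁻¹ a c * ((if b = 0 then 1 else 0) * h a c)
      = (if b = 0 then 1 else 0) * trg g h := by
    simp only [trg, Finset.mul_sum]
    exact Finset.sum_congr rfl fun a _ => Finset.sum_congr rfl fun c _ => by ring
  simp only [mul_neg, mul_add, mul_sub, Finset.sum_neg_distrib, Finset.sum_add_distrib,
    Finset.sum_sub_distrib, e1, e2, e3, e4]
  ring

/-! ### Quadratic forms and Cauchy–Schwarz for the inverse metric -/

open scoped MatrixOrder Matrix.Norms.L2Operator in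
lemma exists_eq_transpose_mul {G : Mat} (hG : G.PosSemidef) : ∃ B : Mat, G = Bᵀ * B := by
  obtain ⟨B, hB⟩ := CStarAlgebra.nonneg_iff_eq_star_mul_self.mp hG.nonneg
  exact ⟨B, by rw [hB, Matrix.star_eq_conjTranspose, Matrix.conjTranspose_eq_transpose_of_trivial]⟩

/-- The quadratic form `M^{ab} p_a p_b`. -/
def quad (M : Mat) (p : Fin 3 → ℝ) : ℝ := ∑ a, ∑ b, M a b * p a * p b

lemma normSq_eq_quad (g : Mat) (p : Fin 3 → ℝ) : normSq g p = quad g⁻¹ p := rfl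

lemma quad_eq_dotProduct (M : Mat) (p : Fin 3 → ℝ) : quad M p = p ⬝ᵥ M *ᵥ p := by
  simp only [quad, dotProduct, Matrix.mulVec, Finset.mul_sum]
  exact Finset.sum_congr rfl fun a _ => Finset.sum_congr rfl fun b _ => by ring

lemma quad_conj (B M : Mat) (p : Fin 3 → ℝ) : quad (Bᵀ * M * B) p = quad M (B *ᵥ p) := by
  rw [quad_eq_dotProduct, quad_eq_dotProduct, ← Matrix.mulVec_mulVec, ← Matrix.mulVec_mulVec,
    Matrix.dotProduct_mulVec, Matrix.vecMul_transpose]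

lemma quad_one (p : Fin 3 → ℝ) : quad 1 p = ∑ i, p i ^ 2 := by
  rw [quad_eq_dotProduct, Matrix.one_mulVec]
  simp [dotProduct, sq]

lemma quad_nonneg {G : Mat} (hG : G.PosSemidef) (p : Fin 3 → ℝ) : 0 ≤ quad G p := by
  obtain ⟨B, rfl⟩ := exists_eq_transpose_mul hG
  rw [← Matrix.mul_one Bᵀ, quad_conj, quad_one]
  positivity

lemma quad_sq_le {M : Mat} (p : Fin 3 → ℝ) :
    quad M p ^ 2 ≤ (∑ a, ∑ b, M a b ^ 2) * (∑ i, p i ^ 2) ^ 2 := by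
  have h := Finset.sum_mul_sq_le_sq_mul_sq (Finset.univ : Finset (Fin 3 × Fin 3))
    (fun x => M x.1 x.2) (fun x => p x.1 * p x.2)
  rw [Fintype.sum_prod_type, Fintype.sum_prod_type, Fintype.sum_prod_type] at h
  have e : ∑ x, ∑ y, (p x * p y) ^ 2 = (∑ i, p i ^ 2) ^ 2 := by
    rw [sq (∑ i, p i ^ 2), Finset.sum_mul_sum]
    simp only [mul_pow]
  simp only [← mul_assoc] at h
  rw [e] at h
  exact h

/-- The mixed tensor `G * h` need not be symmetric, but a Gram factor `B` of `G` acts as an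
orthonormal frame: in it `h` becomes the symmetric `B * h * Bᵀ`, and the trace of the square becomes
a sum of squares of entries. -/
lemma trace_sq_conj {G h : Mat} (hG : G.PosSemidef) (hh : h.IsSymm) :
    ∃ B : Mat, G = Bᵀ * B ∧
      (G * h * (G * h)).trace = ∑ a, ∑ b, (B * h * Bᵀ) a b ^ 2 := by
  obtain ⟨B, rfl⟩ := exists_eq_transpose_mul hG
  refine ⟨B, rfl, ?_⟩
  have hM : (B * h * Bᵀ).IsSymm := by
    rw [Matrix.IsSymm, Matrix.transpose_mul, Matrix.transpose_mul, Matrix.transpose_transpose,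
      hh.eq, Matrix.mul_assoc]
  have : (Bᵀ * B * h * (Bᵀ * B * h)).trace = ((B * h * Bᵀ) * (B * h * Bᵀ)).trace := by
    rw [show Bᵀ * B * h * (Bᵀ * B * h) = Bᵀ * (B * h * Bᵀ * B * h) by simp only [Matrix.mul_assoc],
      Matrix.trace_mul_comm]
    simp only [Matrix.mul_assoc]
  rw [this]
  simp only [Matrix.trace, Matrix.diag, Matrix.mul_apply (M := B * h * Bᵀ)]
  exact Finset.sum_congr rfl fun a _ => Finset.sum_congr rfl fun b _ => by
    rw [hM.apply a b, sq]

lemma trace_sq_nonneg {G h : Mat} (hG : G.PosSemidef) (hh : h.IsSymm) :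
    0 ≤ (G * h * (G * h)).trace := by
  obtain ⟨B, -, e⟩ := trace_sq_conj hG hh
  rw [e]; positivity

lemma abs_quad_raised_le {G h : Mat} (hG : G.PosSemidef) (hh : h.IsSymm) (p : Fin 3 → ℝ) :
    |quad (G * h * G) p| ≤ √((G * h * (G * h)).trace) * quad G p := by
  obtain ⟨B, hB, e⟩ := trace_sq_conj hG hh
  have h1 : quad (G * h * G) p = quad (B * h * Bᵀ) (B *ᵥ p) := by
    rw [← quad_conj, hB]; simp only [Matrix.mul_assoc]
  have h2 : quad G p = ∑ i, (B *ᵥ p) i ^ 2 := by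
    rw [hB, ← Matrix.mul_one Bᵀ, quad_conj, quad_one]
  rw [e, h1, h2]
  generalize B * h * Bᵀ = M
  generalize B *ᵥ p = w
  have h3 := Real.abs_le_sqrt (quad_sq_le (M := M) w)
  rwa [Real.sqrt_mul (by positivity), Real.sqrt_sq (by positivity)] at h3

lemma abs_mulVec_le {G : Mat} (hG : G.PosSemidef) (p : Fin 3 → ℝ) (i : Fin 3) :
    |∑ b, G i b * p b| ≤ √(G i i) * √(quad G p) := by
  obtain ⟨B, hB⟩ := exists_eq_transpose_mul hG
  have h1 : ∑ b, G i b * p b = ∑ m, B m i * (B *ᵥ p) m := by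
    have : (G *ᵥ p) i = (Bᵀ *ᵥ (B *ᵥ p)) i := by rw [Matrix.mulVec_mulVec, hB]
    simpa only [Matrix.mulVec, dotProduct, Matrix.transpose_apply] using this
  have h2 : quad G p = ∑ m, (B *ᵥ p) m ^ 2 := by
    rw [hB, ← Matrix.mul_one Bᵀ, quad_conj, quad_one]
  have h3 : G i i = ∑ m, B m i ^ 2 := by
    rw [hB, Matrix.mul_apply]; simp [sq]
  rw [h1, h2, h3, ← Real.sqrt_mul (by positivity)]
  exact Real.abs_le_sqrt (Finset.sum_mul_sq_le_sq_mul_sq _ _ _)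

lemma isSymm_of_posDef {g : Mat} (hg : g.PosDef) : g.IsSymm := by
  have := hg.isHermitian
  rwa [Matrix.IsHermitian, Matrix.conjTranspose_eq_transpose_of_trivial] at this

lemma inv_mul_of_posDef {g : Mat} (hg : g.PosDef) : g⁻¹ * g = 1 :=
  Matrix.nonsing_inv_mul _ ((Matrix.isUnit_iff_isUnit_det _).1 hg.isUnit)

/-! ### Moments of the distribution function -/

lemma continuous_normSq (g : Mat) : Continuous (normSq g) := by
  unfold normSq; fun_prop

lemma continuous_pZero (g : Mat) : Continuous (pZero g) :=
  (continuous_const.add (continuous_normSq g)).sqrt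

lemma one_le_pZero {g : Mat} (hg : g.PosDef) (p : Fin 3 → ℝ) : 1 ≤ pZero g p := by
  rw [pZero, Real.one_le_sqrt]
  have := quad_nonneg hg.inv.posSemidef p
  rw [normSq_eq_quad]; linarith

lemma integrable_moment {g : Mat} (hg : g.PosDef) {f ψ : (Fin 3 → ℝ) → ℝ} (hf : Continuous f)
    (hc : HasCompactSupport f) (hψ : Continuous ψ) :
    MeasureTheory.Integrable fun v : Fin 3 → ℝ => f (g *ᵥ v) * ψ (g *ᵥ v) * √g.det := by
  have hm : Continuous fun v : Fin 3 → ℝ => g *ᵥ v := by fun_prop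
  have hcomp : HasCompactSupport fun v : Fin 3 → ℝ => f (g *ᵥ v) := by
    have hinv : Continuous fun p : Fin 3 → ℝ => g⁻¹ *ᵥ p := by fun_prop
    refine HasCompactSupport.intro (hc.isCompact.image hinv) fun v hv => ?_
    by_contra hne
    refine hv ⟨g *ᵥ v, subset_tsupport _ hne, ?_⟩
    simp [Matrix.mulVec_mulVec, inv_mul_of_posDef hg]
  refine Continuous.integrable_of_hasCompactSupport (by fun_prop) ?_
  exact (hcomp.mul_right (f' := fun v => ψ (g *ᵥ v))).mul_right

section Moments

variable {g : Mat} {f : (Fin 3 → ℝ) → ℝ}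

lemma sum_mul_stress (hg : g.PosDef) (hf : Continuous f) (hc : HasCompactSupport f) (M : Mat) :
    ∑ a, ∑ b, M a b * stress g f a b
      = ∫ v : Fin 3 → ℝ, f (g *ᵥ v) * (quad M (g *ᵥ v) * (pZero g (g *ᵥ v))⁻¹) * √g.det := by
  have hp : Continuous fun p => (pZero g p)⁻¹ :=
    (continuous_pZero g).inv₀ fun p => (zero_lt_one.trans_le (one_le_pZero hg p)).ne'
  have hi : ∀ a b, MeasureTheory.Integrable fun v : Fin 3 → ℝ =>
      M a b * (f (g *ᵥ v) * (g *ᵥ v) a * (g *ᵥ v) b * (pZero g (g *ᵥ v))⁻¹ * √g.det) := by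
    intro a b
    have := integrable_moment hg hf hc (ψ := fun p => p a * p b * (pZero g p)⁻¹) (by fun_prop)
    refine (this.congr (.of_forall fun v => ?_)).const_mul _
    simp only; ring
  simp only [stress, ← MeasureTheory.integral_const_mul]
  simp only [← MeasureTheory.integral_finsetSum Finset.univ fun b _ => hi _ b]
  rw [← MeasureTheory.integral_finsetSum _
    fun a _ => MeasureTheory.integrable_finsetSum _ fun b _ => hi a b]
  refine MeasureTheory.integral_congr_ae (.of_forall fun v => ?_)
  simp only [quad, Finset.sum_mul, Finset.mul_sum]
  exact Finset.sum_congr rfl fun a _ => Finset.sum_congr rfl fun b _ => by ring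

lemma energyDensity_nonneg (hf0 : ∀ p, 0 ≤ f p) : 0 ≤ energyDensity g f := by
  refine MeasureTheory.integral_nonneg fun v => ?_
  have : 0 ≤ pZero g (g *ᵥ v) := Real.sqrt_nonneg _
  have := hf0 (g *ᵥ v)
  positivity

lemma continuous_quad (M : Mat) : Continuous (quad M) := by
  unfold quad; fun_prop

lemma integrable_quad_div (hg : g.PosDef) (hf : Continuous f) (hc : HasCompactSupport f)
    (M : Mat) : MeasureTheory.Integrable fun v : Fin 3 → ℝ =>
      f (g *ᵥ v) * (quad M (g *ᵥ v) * (pZero g (g *ᵥ v))⁻¹) * √g.det :=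
  integrable_moment hg hf hc (ψ := fun p => quad M p * (pZero g p)⁻¹)
    ((continuous_quad M).mul ((continuous_pZero g).inv₀
      fun p => (zero_lt_one.trans_le (one_le_pZero hg p)).ne'))

lemma trg_stress_nonneg (hg : g.PosDef) (hf : Continuous f) (hc : HasCompactSupport f)
    (hf0 : ∀ p, 0 ≤ f p) : 0 ≤ trg g (stress g f) := by
  rw [trg, sum_mul_stress hg hf hc]
  refine MeasureTheory.integral_nonneg fun v => ?_
  have h1 := hf0 (g *ᵥ v)
  have h2 : 0 ≤ quad g⁻¹ (g *ᵥ v) := quad_nonneg hg.inv.posSemidef _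
  have h3 : 0 ≤ pZero g (g *ᵥ v) := Real.sqrt_nonneg _
  positivity

lemma trg_stress_le (hg : g.PosDef) (hf : Continuous f) (hc : HasCompactSupport f)
    (hf0 : ∀ p, 0 ≤ f p) : trg g (stress g f) ≤ energyDensity g f := by
  rw [trg, sum_mul_stress hg hf hc]
  refine MeasureTheory.integral_mono (integrable_quad_div hg hf hc _)
    (integrable_moment hg hf hc (continuous_pZero g)) fun v => ?_
  have h3 := one_le_pZero hg (g *ᵥ v)
  have h4 : pZero g (g *ᵥ v) ^ 2 = 1 + quad g⁻¹ (g *ᵥ v) := by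
    have := quad_nonneg hg.inv.posSemidef (g *ᵥ v)
    exact Real.sq_sqrt (by rw [normSq_eq_quad]; linarith)
  have h5 : quad g⁻¹ (g *ᵥ v) * (pZero g (g *ᵥ v))⁻¹ ≤ pZero g (g *ᵥ v) := by
    rw [← div_eq_mul_inv, div_le_iff₀ (by linarith)]; nlinarith
  exact mul_le_mul_of_nonneg_right (mul_le_mul_of_nonneg_left h5 (hf0 _)) (Real.sqrt_nonneg _)

/-- The pointwise bound `|h(p,p)| ≤ |h| |p|²` integrated against the nonnegative `f`. With `h` the
shear it controls the matter source of the shear. -/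
lemma abs_sum_raised_mul_stress_le (hg : g.PosDef) (hf : Continuous f) (hc : HasCompactSupport f)
    (hf0 : ∀ p, 0 ≤ f p) {h : Mat} (hh : h.IsSymm) :
    |∑ a, ∑ b, (g⁻¹ * h * g⁻¹) a b * stress g f a b|
      ≤ √((g⁻¹ * h * (g⁻¹ * h)).trace) * trg g (stress g f) := by
  rw [trg, sum_mul_stress hg hf hc, sum_mul_stress hg hf hc, ← MeasureTheory.integral_const_mul]
  refine MeasureTheory.abs_integral_le_integral_abs.trans
    (MeasureTheory.integral_mono (integrable_quad_div hg hf hc _).abs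
      ((integrable_quad_div hg hf hc _).const_mul _) fun v => ?_)
  have h1 := hf0 (g *ᵥ v)
  have h2 := abs_quad_raised_le hg.inv.posSemidef hh (g *ᵥ v)
  have h3 : 0 ≤ (pZero g (g *ᵥ v))⁻¹ := inv_nonneg.2 (Real.sqrt_nonneg _)
  simp only [abs_mul, abs_of_nonneg h1, abs_of_nonneg h3, abs_of_nonneg (Real.sqrt_nonneg g.det)]
  calc _ ≤ f (g *ᵥ v) * (√((g⁻¹ * h * (g⁻¹ * h)).trace) * quad g⁻¹ (g *ᵥ v)
          * (pZero g (g *ᵥ v))⁻¹) * √g.det := by gcongr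
    _ = _ := by ring

/-- Cauchy–Schwarz on the support of `f`, where momenta have length at most `d`, together with `p^0
≥ 1`. The factor `d` makes the current small relative to the energy density. -/
lemma abs_raise_current_le (hg : g.PosDef) (hf : Continuous f) (hc : HasCompactSupport f)
    (hf0 : ∀ p, 0 ≤ f p) {d : ℝ} (hd : 0 ≤ d) (hs : ∀ p, f p ≠ 0 → normSq g p ≤ d ^ 2) :
    |∑ b, g⁻¹ 0 b * current g f b| ≤ √(g⁻¹ 0 0) * d * energyDensity g f := by
  have hi : ∀ b, MeasureTheory.Integrable fun v : Fin 3 → ℝ =>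
      g⁻¹ 0 b * (f (g *ᵥ v) * (g *ᵥ v) b * √g.det) := fun b =>
    (integrable_moment hg hf hc (ψ := fun p => p b) (by fun_prop)).const_mul _
  simp only [current, energyDensity, ← MeasureTheory.integral_const_mul]
  rw [← MeasureTheory.integral_finsetSum Finset.univ fun b _ => hi b]
  refine MeasureTheory.abs_integral_le_integral_abs.trans
    (MeasureTheory.integral_mono (MeasureTheory.integrable_finsetSum _ fun b _ => hi b).abs
      ((integrable_moment hg hf hc (continuous_pZero g)).const_mul _) fun v => ?_)
  have e : ∑ b, g⁻¹ 0 b * (f (g *ᵥ v) * (g *ᵥ v) b * √g.det)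
      = f (g *ᵥ v) * (∑ b, g⁻¹ 0 b * (g *ᵥ v) b) * √g.det := by
    simp only [Finset.mul_sum, Finset.sum_mul]
    exact Finset.sum_congr rfl fun b _ => by ring
  have h1 := hf0 (g *ᵥ v)
  simp only [e, abs_mul, abs_of_nonneg h1, abs_of_nonneg (Real.sqrt_nonneg g.det)]
  by_cases hz : f (g *ᵥ v) = 0
  · simp [hz]
  have h2 := abs_mulVec_le hg.inv.posSemidef (g *ᵥ v) 0
  have h3 : √(quad g⁻¹ (g *ᵥ v)) ≤ d := Real.sqrt_le_iff.2 ⟨hd, hs _ hz⟩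
  have h4 := one_le_pZero hg (g *ᵥ v)
  calc _ ≤ f (g *ᵥ v) * (√(g⁻¹ 0 0) * d) * √g.det := by
        gcongr; exact h2.trans (by gcongr)
    _ ≤ f (g *ᵥ v) * (√(g⁻¹ 0 0) * d * pZero g (g *ᵥ v)) * √g.det := by
        have h5 := le_mul_of_one_le_right (show 0 ≤ √(g⁻¹ 0 0) * d by positivity) h4
        gcongr
    _ = _ := by ring

end Moments

/-! ### Calculus of matrix-valued functions -/

/-- Entrywise derivative of a matrix-valued function within a set. -/
def HasEntryDeriv (A : ℝ → Mat) (A' : Mat) (s : Set ℝ) (t : ℝ) : Prop :=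
  ∀ a b, HasDerivWithinAt (fun τ => A τ a b) (A' a b) s t

namespace HasEntryDeriv

variable {A B : ℝ → Mat} {A' B' : Mat} {s : Set ℝ} {t : ℝ}

lemma mul (hA : HasEntryDeriv A A' s t) (hB : HasEntryDeriv B B' s t) :
    HasEntryDeriv (fun τ => A τ * B τ) (A' * B t + A t * B') s t := by
  intro a b
  simp only [Matrix.add_apply, Matrix.mul_apply, ← Finset.sum_add_distrib]
  exact HasDerivWithinAt.fun_sum fun c _ => (hA a c).mul (hB c b)

lemma trace (hA : HasEntryDeriv A A' s t) :
    HasDerivWithinAt (fun τ => (A τ).trace) A'.trace s t :=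
  HasDerivWithinAt.fun_sum fun a _ => hA a a

lemma unique (hA : HasEntryDeriv A A' s t) (hB : HasEntryDeriv A B' s t)
    (hs : UniqueDiffWithinAt ℝ s t) : A' = B' := by
  ext a b
  exact hs.eq_deriv _ (hA a b) (hB a b)

lemma exists_inv (hA : HasEntryDeriv A A' s t) (h0 : (A t).det ≠ 0) :
    ∃ D, HasEntryDeriv (fun τ => (A τ)⁻¹) D s t := by
  have hd : ∀ a b, DifferentiableWithinAt ℝ (fun τ => A τ a b) s t :=
    fun a b => (hA a b).differentiableWithinAt
  have hdet : DifferentiableWithinAt ℝ (fun τ => (A τ).det) s t := by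
    simp only [Matrix.det_fin_three]
    fun_prop
  have hadj : ∀ a b, DifferentiableWithinAt ℝ (fun τ => (A τ).adjugate a b) s t := by
    intro a b
    simp only [Matrix.adjugate_fin_three]
    fin_cases a <;> fin_cases b <;> simp <;> fun_prop
  refine ⟨fun a b => derivWithin (fun τ => (A τ)⁻¹ a b) s t, fun a b => ?_⟩
  refine DifferentiableWithinAt.hasDerivWithinAt ?_
  simp only [Matrix.inv_def, Ring.inverse_eq_inv', Matrix.smul_apply, smul_eq_mul]
  exact (hdet.inv h0).mul (hadj a b)

/-- Cramer's rule supplies some derivative; differentiating `A⁻¹ * A = 1` identifies it. -/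
lemma inv (hA : HasEntryDeriv A A' s t) (h0 : ∀ τ ∈ s, (A τ).det ≠ 0) (ht : t ∈ s)
    (hs : UniqueDiffWithinAt ℝ s t) :
    HasEntryDeriv (fun τ => (A τ)⁻¹) (-((A t)⁻¹ * A' * (A t)⁻¹)) s t := by
  obtain ⟨D, hD⟩ := exists_inv hA (h0 t ht)
  have h1 : HasEntryDeriv (fun τ => (A τ)⁻¹ * A τ) 0 s t := by
    intro a b
    refine (hasDerivWithinAt_const t s ((1 : Mat) a b)).congr_of_mem (fun τ hτ => ?_) ht
    exact congrFun (congrFun (Matrix.nonsing_inv_mul _ (h0 τ hτ).isUnit) a) b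
  have h2 := (hD.mul hA).unique h1 hs
  have h3 : D = -((A t)⁻¹ * A' * (A t)⁻¹) := by
    have h4 := congrArg (· * (A t)⁻¹) h2
    simp only [add_mul, zero_mul, Matrix.mul_assoc,
      Matrix.mul_nonsing_inv _ (h0 t ht).isUnit, Matrix.mul_one] at h4
    rw [eq_neg_iff_add_eq_zero, Matrix.mul_assoc]
    exact h4
  rwa [← h3]

end HasEntryDeriv

/-! ### Algebra of the shear on one slice -/

lemma stress_isSymm (g : Mat) (f : (Fin 3 → ℝ) → ℝ) : (stress g f).IsSymm := by
  ext a b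
  simp only [Matrix.transpose_apply, stress]
  congr 1; ext v; ring

lemma sum_mul_eq_trace {M S : Mat} (hS : S.IsSymm) :
    ∑ a, ∑ b, M a b * S a b = (M * S).trace := by
  simp only [Matrix.trace, Matrix.diag, Matrix.mul_apply]
  exact Finset.sum_congr rfl fun a _ => Finset.sum_congr rfl fun b _ => by rw [hS.apply]

/-- `σ_{ab} σ^{ab}`. -/
noncomputable def shearSq (g k : Mat) : ℝ := (g⁻¹ * shear g k * (g⁻¹ * shear g k)).trace

/-- `σ^{ab}`. -/
noncomputable def shearUp (g k : Mat) : Mat := g⁻¹ * shear g k * g⁻¹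

lemma shear_isSymm {g k : Mat} (hg : g.IsSymm) (hk : k.IsSymm) : (shear g k).IsSymm :=
  hk.add (hg.smul _)

section Slice

variable {g k : Mat}

lemma inv_mul_shear (hg : g.PosDef) :
    g⁻¹ * shear g k = g⁻¹ * k + hubble g k • (1 : Mat) := by
  rw [shear, Matrix.mul_add, Matrix.mul_smul, inv_mul_of_posDef hg]

lemma shearUp_eq (hg : g.PosDef) :
    shearUp g k = g⁻¹ * k * g⁻¹ + hubble g k • g⁻¹ := by
  rw [shearUp, inv_mul_shear hg, Matrix.add_mul, Matrix.smul_mul, Matrix.one_mul]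

lemma trace_inv_mul (hk : k.IsSymm) : (g⁻¹ * k).trace = -3 * hubble g k := by
  rw [← trg_eq_trace hk, hubble]; ring

lemma shearSq_eq (hg : g.PosDef) (hk : k.IsSymm) :
    shearSq g k = (g⁻¹ * k * (g⁻¹ * k)).trace - 3 * hubble g k ^ 2 := by
  rw [shearSq, inv_mul_shear hg]
  generalize hm : g⁻¹ * k = m
  have h := trace_inv_mul (g := g) hk
  rw [hm] at h
  simp only [add_mul, mul_add, Matrix.smul_mul, Matrix.mul_smul, Matrix.one_mul, Matrix.mul_one,
    Matrix.trace_add, Matrix.trace_smul, h, Matrix.trace_one, smul_eq_mul, Fintype.card_fin]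
  push_cast
  ring

lemma trace_shearUp_mul (hg : g.PosDef) (S : Mat) :
    (shearUp g k * S).trace
      = (g⁻¹ * k * (g⁻¹ * S)).trace + hubble g k * (g⁻¹ * S).trace := by
  rw [shearUp_eq hg]
  simp only [add_mul, Matrix.smul_mul, Matrix.trace_add, Matrix.trace_smul, smul_eq_mul,
    Matrix.mul_assoc]

lemma sum_kk_eq (hg : g.PosDef) (hk : k.IsSymm) :
    (∑ a, ∑ b, ∑ c, ∑ d, g⁻¹ a c * g⁻¹ b d * k a b * k c d)
      = (g⁻¹ * k * (g⁻¹ * k)).trace := by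
  have hi : g⁻¹.IsSymm := (isSymm_of_posDef hg).inv
  have e : ∀ a b, ∑ c, ∑ d, g⁻¹ a c * g⁻¹ b d * k a b * k c d
      = (g⁻¹ * k * g⁻¹) a b * k a b := by
    intro a b
    simp only [Matrix.mul_apply, Finset.sum_mul]
    rw [Finset.sum_comm]
    exact Finset.sum_congr rfl fun d _ => Finset.sum_congr rfl fun c _ => by
      rw [hi.apply d b]; ring
  simp only [e]
  rw [sum_mul_eq_trace hk, Matrix.mul_assoc]

end Slice

/-! ### Evolution equations and constraints in terms of `H`, `|σ|²` and `g⁻¹` -/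

section Evolution

variable {t₀ t : ℝ} {g k : ℝ → Mat} {f : ℝ → (Fin 3 → ℝ) → ℝ}

/-- Symmetry is inherited from `g`, because `k` is `-1/2` times its derivative and one-sided
derivatives are unique. -/
lemma IsSolution.k_isSymm (h : IsSolution t₀ g k f) (ht : t₀ ≤ t) : (k t).IsSymm := by
  ext a b
  have h1 := h.deriv_g t ht b a
  have h2 : HasDerivWithinAt (fun s => g s b a) (-2 * k t a b) (Set.Ici t₀) t :=
    (h.deriv_g t ht a b).congr_of_mem (fun s hs => (isSymm_of_posDef (h.posDef s hs)).apply a b) ht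
  have := (uniqueDiffOn_Ici t₀ t ht).eq_deriv _ h1 h2
  rw [Matrix.transpose_apply]; linarith

lemma IsSolution.hubble_pos (h : IsSolution t₀ g k f) (ht : t₀ ≤ t) :
    0 < hubble (g t) (k t) := by
  have := h.expanding t ht
  rw [hubble]; linarith

lemma IsSolution.hasEntryDeriv_inv (h : IsSolution t₀ g k f) (ht : t₀ ≤ t) :
    HasEntryDeriv (fun τ => (g τ)⁻¹)
      ((2 : ℝ) • shearUp (g t) (k t) - (2 * hubble (g t) (k t)) • (g t)⁻¹) (Set.Ici t₀) t := by
  have hg : HasEntryDeriv g ((-2 : ℝ) • k t) (Set.Ici t₀) t := fun a b => by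
    simpa using h.deriv_g t ht a b
  have := hg.inv (fun τ hτ => (h.posDef τ hτ).det_pos.ne') ht (uniqueDiffOn_Ici t₀ t ht)
  rw [shearUp_eq (h.posDef t ht)]
  convert this using 1
  ext a b
  simp only [Matrix.mul_smul, Matrix.smul_mul, Matrix.sub_apply, Matrix.add_apply,
    Matrix.smul_apply, Matrix.neg_apply, smul_eq_mul]
  ring

/-- Raising one index cancels the term quadratic in `k`, and the Ricci tensor contributes only a
multiple of the identity. -/
lemma IsSolution.hasEntryDeriv_mixed (h : IsSolution t₀ g k f) (ht : t₀ ≤ t) :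
    HasEntryDeriv (fun τ => (g τ)⁻¹ * k τ)
      ((-2 * (g t)⁻¹ 0 0 + 4 * Real.pi * (trg (g t) (stress (g t) (f t))
          - energyDensity (g t) (f t))) • (1 : Mat)
        - (3 * hubble (g t) (k t)) • ((g t)⁻¹ * k t)
        - (8 * Real.pi) • ((g t)⁻¹ * stress (g t) (f t))) (Set.Ici t₀) t := by
  have hgt := h.posDef t ht
  have hs := isSymm_of_posDef hgt
  have hG := inv_mul_of_posDef hgt
  have hk : HasEntryDeriv k
      ((-2 * (g t)⁻¹ 0 0 + 4 * Real.pi * (trg (g t) (stress (g t) (f t))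
          - energyDensity (g t) (f t))) • g t
        - (3 * hubble (g t) (k t)) • k t - (2 : ℝ) • (k t * (g t)⁻¹ * k t)
        - (8 * Real.pi) • stress (g t) (f t)) (Set.Ici t₀) t := by
    intro a b
    have hd := h.deriv_k t ht a b
    refine hd.congr_deriv ?_
    have e : ∑ c, ∑ d, k t a c * (g t)⁻¹ c d * k t d b = (k t * (g t)⁻¹ * k t) a b := by
      simp only [Matrix.mul_apply, Finset.sum_mul]
      rw [Finset.sum_comm]
    have eT : trg (g t) (k t) = -3 * hubble (g t) (k t) := by rw [hubble]; ring
    rw [e, ricci_structConst hs hG, eT]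
    simp only [Matrix.sub_apply, Matrix.smul_apply, smul_eq_mul]
    ring
  have := (h.hasEntryDeriv_inv ht).mul hk
  convert this using 1
  rw [shearUp_eq hgt]
  simp only [Matrix.mul_sub, Matrix.mul_smul, hG, Matrix.sub_mul, Matrix.smul_mul, Matrix.add_mul,
    Matrix.mul_assoc]
  ext a b
  simp only [Matrix.sub_apply, Matrix.add_apply, Matrix.smul_apply, smul_eq_mul]
  ring

lemma IsSolution.hamiltonian_eq (h : IsSolution t₀ g k f) (ht : t₀ ≤ t) :
    6 * hubble (g t) (k t) ^ 2 - 6 * (g t)⁻¹ 0 0 - shearSq (g t) (k t)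
      = 16 * Real.pi * energyDensity (g t) (f t) := by
  have hgt := h.posDef t ht
  have hk := h.k_isSymm ht
  have e := h.hamiltonian t ht
  rw [scalarCurv_structConst (isSymm_of_posDef hgt) (inv_mul_of_posDef hgt), sum_kk_eq hgt hk] at e
  have eT : trg (g t) (k t) = -3 * hubble (g t) (k t) := by rw [hubble]; ring
  rw [eT] at e
  rw [shearSq_eq hgt hk, ← e]
  ring

/-- The momentum constraint contracted with the first row of the inverse metric. It bounds by matter
the shear component that enters the derivative of `g⁻¹ 0 0`. -/
lemma IsSolution.momentum_eq (h : IsSolution t₀ g k f) (ht : t₀ ≤ t) :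
    3 * shearUp (g t) (k t) 0 0
      = -(8 * Real.pi) * ∑ b, (g t)⁻¹ 0 b * current (g t) (f t) b := by
  have hgt := h.posDef t ht
  have hs := isSymm_of_posDef hgt
  have hk := h.k_isSymm ht
  have e : ∀ b, 8 * Real.pi * current (g t) (f t) b
      = -(3 * ((g t)⁻¹ * k t) 0 b - (if b = 0 then 1 else 0) * (-3 * hubble (g t) (k t))) := by
    intro b
    rw [← h.momentum t ht b, divergence_structConst hs (inv_mul_of_posDef hgt) hk]
    congr 3
    rw [hubble]; ring
  have e2 : 8 * Real.pi * ∑ b, (g t)⁻¹ 0 b * current (g t) (f t) b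
      = ∑ b, (g t)⁻¹ 0 b * (8 * Real.pi * current (g t) (f t) b) := by
    rw [Finset.mul_sum]; exact Finset.sum_congr rfl fun b _ => by ring
  rw [neg_mul, e2, shearUp_eq hgt, Matrix.add_apply, Matrix.mul_apply]
  have hi : ∀ b, (g t)⁻¹ 0 b = (g t)⁻¹ b 0 := fun b => hs.inv.apply b 0
  simp only [e, Fin.sum_univ_three, hi 1, hi 2, Matrix.smul_apply, smul_eq_mul]
  simp
  ring

lemma IsSolution.hasDerivWithinAt_hubble (h : IsSolution t₀ g k f) (ht : t₀ ≤ t) :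
    HasDerivWithinAt (fun τ => hubble (g τ) (k τ))
      (-hubble (g t) (k t) ^ 2 - shearSq (g t) (k t) / 3
        - 4 * Real.pi / 3 * (energyDensity (g t) (f t) + trg (g t) (stress (g t) (f t))))
      (Set.Ici t₀) t := by
  have h1 := ((h.hasEntryDeriv_mixed ht).trace.const_mul (-(1 / 3))).congr_of_mem
    (f₁ := fun τ => hubble (g τ) (k τ))
    (fun τ hτ => by rw [trace_inv_mul (h.k_isSymm hτ)]; ring) ht
  refine h1.congr_deriv ?_
  have e := h.hamiltonian_eq ht
  simp only [Matrix.trace_sub, Matrix.trace_smul, Matrix.trace_one, smul_eq_mul,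
    trace_inv_mul (h.k_isSymm ht), ← trg_eq_trace (stress_isSymm (g t) (f t)), Fintype.card_fin]
  push_cast
  -- The Hamiltonian constraint removes the curvature term, leaving Raychaudhuri's equation.
  linear_combination (-1 / 3) * e

lemma IsSolution.hasDerivWithinAt_shearSq (h : IsSolution t₀ g k f) (ht : t₀ ≤ t) :
    HasDerivWithinAt (fun τ => shearSq (g τ) (k τ))
      (-6 * hubble (g t) (k t) * shearSq (g t) (k t)
        - 16 * Real.pi * ∑ a, ∑ b, shearUp (g t) (k t) a b * stress (g t) (f t) a b)
      (Set.Ici t₀) t := by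
  have hgt := h.posDef t ht
  have hk := h.k_isSymm ht
  have hm := h.hasEntryDeriv_mixed ht
  have h1 := ((hm.mul hm).trace.sub (((h.hasDerivWithinAt_hubble ht).pow 2).const_mul 3)).congr_of_mem
    (f₁ := fun τ => shearSq (g τ) (k τ))
    (fun τ hτ => by rw [shearSq_eq (h.posDef τ hτ) (h.k_isSymm hτ)]; rfl) ht
  refine h1.congr_deriv ?_
  have e := h.hamiltonian_eq ht
  rw [sum_mul_eq_trace (stress_isSymm _ _), trace_shearUp_mul hgt]
  have hT := trace_inv_mul (g := g t) hk
  have hQ := shearSq_eq hgt hk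
  simp only [Matrix.sub_mul, Matrix.mul_sub, Matrix.smul_mul, Matrix.mul_smul, Matrix.one_mul,
    Matrix.mul_one, Matrix.trace_add, Matrix.trace_sub, Matrix.trace_smul, smul_eq_mul,
    Matrix.trace_mul_comm ((g t)⁻¹ * stress (g t) (f t)) ((g t)⁻¹ * k t), hT,
    trg_eq_trace (stress_isSymm (g t) (f t))]
  rw [show ((g t)⁻¹ * k t * ((g t)⁻¹ * k t)).trace
    = shearSq (g t) (k t) + 3 * hubble (g t) (k t) ^ 2 by rw [hQ]; ring]
  push_cast
  linear_combination (-2 * hubble (g t) (k t)) * e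

end Evolution

/-! ### Backward solvability of ordinary differential equations -/

lemma hasDerivWithinAt_of_notMem_closure {E : Type*} [NormedAddCommGroup E] [NormedSpace ℝ E]
    {V : ℝ → E} {V' : E} {s : Set ℝ} {t : ℝ} (h : t ∉ closure s) : HasDerivWithinAt V V' s t :=
  HasFDerivWithinAt.of_notMem_closure h

lemma hasDerivWithinAt_piecewise {E : Type*} [NormedAddCommGroup E] [NormedSpace ℝ E]
    {F : ℝ → E → E} {V₁ V₂ : ℝ → E} {a b c : ℝ} (hab : a ≤ b) (hbc : b ≤ c)
    (h : V₁ b = V₂ b)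
    (h₁ : ∀ t ∈ Set.Icc a b, HasDerivWithinAt V₁ (F t (V₁ t)) (Set.Icc a b) t)
    (h₂ : ∀ t ∈ Set.Icc b c, HasDerivWithinAt V₂ (F t (V₂ t)) (Set.Icc b c) t) :
    ∀ t ∈ Set.Icc a c, HasDerivWithinAt (fun s => if s ≤ b then V₁ s else V₂ s)
      (F t (if t ≤ b then V₁ t else V₂ t)) (Set.Icc a c) t := by
  intro t ht
  have e₁ : ∀ s ∈ Set.Icc a b, (if s ≤ b then V₁ s else V₂ s) = V₁ s :=
    fun s hs => if_pos hs.2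
  have e₂ : ∀ s ∈ Set.Icc b c, (if s ≤ b then V₁ s else V₂ s) = V₂ s := by
    intro s hs
    split_ifs with hsb
    · rw [le_antisymm hsb hs.1, h]
    · rfl
  rw [← Set.Icc_union_Icc_eq_Icc hab hbc]
  refine HasDerivWithinAt.union ?_ ?_
  · by_cases hm : t ∈ Set.Icc a b
    · rw [e₁ t hm]
      exact (h₁ t hm).congr_of_mem e₁ hm
    · exact hasDerivWithinAt_of_notMem_closure (by rwa [closure_Icc])
  · by_cases hm : t ∈ Set.Icc b c
    · rw [e₂ t hm]
      exact (h₂ t hm).congr_of_mem e₂ hm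
    · exact hasDerivWithinAt_of_notMem_closure (by rwa [closure_Icc])

/-- Backward solvability of an ordinary differential equation whose right-hand side is locally
Lipschitz and of linear growth. -/
lemma exists_solution_of_linear_growth {E : Type*} [NormedAddCommGroup E] [NormedSpace ℝ E]
    [CompleteSpace E] {F : ℝ → E → E} {a c κ : ℝ} (hκ : 0 < κ)
    (hgrowth : ∀ t ∈ Set.Icc a c, ∀ v, ‖F t v‖ ≤ κ * ‖v‖)
    (hlip : ∀ R : ℝ, ∃ K : NNReal, ∀ t ∈ Set.Icc a c,
      LipschitzOnWith K (F t) (Metric.closedBall 0 R))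
    (hcont : ∀ v, ContinuousOn (fun t => F t v) (Set.Icc a c)) (n : ℕ) :
    ∀ T ∈ Set.Icc a c, T - a ≤ n * (1 / (2 * κ)) → ∀ p : E, ∃ V : ℝ → E, V T = p ∧
      ∀ t ∈ Set.Icc a T, HasDerivWithinAt V (F t (V t)) (Set.Icc a T) t := by
  induction n with
  | zero =>
    intro T hT hn p
    obtain rfl : T = a := le_antisymm (by simpa using hn) hT.1
    refine ⟨fun _ => p, rfl, fun t ht => ?_⟩
    rw [Set.Icc_self] at ht ⊢
    -- The interval is a single point, within which every value is a derivative.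
    rw [← hasDerivWithinAt_sdiff_singleton]
    refine hasDerivWithinAt_of_notMem_closure fun hm => ?_
    rw [show t = T from Set.mem_singleton_iff.1 ht] at hm
    simp at hm
  | succ n ih =>
    intro T hT hn p
    -- On the ball of radius `‖p‖ + 1` about `p` the field is at most `κ (2‖p‖ + 1)`, so time `1 /
    -- (2κ)` never leaves it. This step length does not depend on `p`, so finitely many steps reach
    -- `a`.
    set b := max a (T - 1 / (2 * κ)) with hb
    have hab : a ≤ b := le_max_left _ _
    have hbT : b ≤ T := max_le hT.1 (by
      have : 0 < 1 / (2 * κ) := by positivity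
      linarith)
    have hsub : Set.Icc b T ⊆ Set.Icc a c := Set.Icc_subset_Icc hab hT.2
    obtain ⟨K, hK⟩ := hlip (2 * ‖p‖ + 1)
    have hball : Metric.closedBall p (‖p‖ + 1) ⊆ Metric.closedBall 0 (2 * ‖p‖ + 1) :=
      Metric.closedBall_subset_closedBall' (by rw [dist_zero_right]; linarith)
    have hPL : IsPicardLindelof F (tmin := b) (tmax := T) ⟨T, hbT, le_rfl⟩ p (‖p‖₊ + 1) 0
        (κ.toNNReal * (2 * ‖p‖₊ + 1)) K := by
      refine ⟨fun t ht => (hK t (hsub ht)).mono (by simpa using hball),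
        fun v _ => (hcont v).mono hsub, fun t ht v hv => ?_, ?_⟩
      · have hv' := hball (by simpa using hv)
        rw [mem_closedBall_zero_iff] at hv'
        refine (hgrowth t (hsub ht) v).trans ?_
        push_cast
        rw [Real.coe_toNNReal _ hκ.le]
        gcongr
      · have h1 : T - b ≤ 1 / (2 * κ) := by
          have := le_max_right a (T - 1 / (2 * κ)); rw [← hb] at this; linarith
        have h2 : max (T - T) (T - b) = T - b := by
          rw [sub_self]; exact max_eq_right (by linarith)
        push_cast
        rw [Real.coe_toNNReal _ hκ.le, h2]
        calc κ * (2 * ‖p‖ + 1) * (T - b) ≤ κ * (2 * ‖p‖ + 1) * (1 / (2 * κ)) := by gcongr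
          _ = ‖p‖ + 1 / 2 := by field_simp
          _ ≤ ‖p‖ + 1 - 0 := by linarith
    obtain ⟨V₂, h2T, h2⟩ := hPL.exists_eq_forall_mem_Icc_hasDerivWithinAt₀
    obtain ⟨V₁, h1b, h1⟩ := ih b ⟨hab, hbT.trans hT.2⟩ (by
      have h3 : (0 : ℝ) ≤ n * (1 / (2 * κ)) := by positivity
      push_cast at hn
      rcases max_choice a (T - 1 / (2 * κ)) with h | h <;> rw [hb, h] <;> linarith) (V₂ b)
    refine ⟨fun s => if s ≤ b then V₁ s else V₂ s, ?_,
      hasDerivWithinAt_piecewise hab hbT h1b h1 h2⟩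
    simp only
    split_ifs with hTb
    · rw [le_antisymm hTb hbT, h1b, le_antisymm hbT hTb]; exact h2T
    · exact h2T

/-! ### Regularity and growth of the Vlasov force -/

/-- The force as a function of the inverse metric and the momentum. -/
noncomputable def forceOfInv (x : (Fin 3 → Fin 3 → ℝ) × (Fin 3 → ℝ)) (a : Fin 3) : ℝ :=
  (√(1 + ∑ i, ∑ j, x.1 i j * x.2 i * x.2 j))⁻¹ *
    ∑ b, ∑ d, structConst d b a * (∑ c, x.1 b c * x.2 c) * x.2 d

lemma force_eq_forceOfInv (g : Mat) (p : Fin 3 → ℝ) :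
    force structConst g p = forceOfInv (fun i j => g⁻¹ i j, p) := rfl

lemma contDiffAt_forceOfInv {x : (Fin 3 → Fin 3 → ℝ) × (Fin 3 → ℝ)}
    (hx : 0 < 1 + ∑ i, ∑ j, x.1 i j * x.2 i * x.2 j) : ContDiffAt ℝ 1 forceOfInv x := by
  rw [contDiffAt_pi]
  intro a
  unfold forceOfInv
  refine ContDiffAt.mul (ContDiffAt.inv (ContDiffAt.sqrt ?_ hx.ne') (Real.sqrt_pos.2 hx).ne') ?_
  · fun_prop
  · fun_prop

/-- The force is quadratic in `p`, but one factor is absorbed by `p^0`, since `|p^b| ≤ √(g⁻¹ b b)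
p^0`. The linear growth that remains excludes blow-up. -/
lemma norm_force_le {g : Mat} (hg : g.PosDef) (p : Fin 3 → ℝ) :
    ‖force structConst g p‖ ≤ (3 * ∑ b, √(g⁻¹ b b)) * ‖p‖ := by
  refine (pi_norm_le_iff_of_nonneg (by positivity)).2 fun a => ?_
  have h0 := one_le_pZero hg p
  have hr : ∀ b, |raise g p b| ≤ √(g⁻¹ b b) * pZero g p := by
    intro b
    refine (abs_mulVec_le hg.inv.posSemidef p b).trans ?_
    gcongr
    exact Real.sqrt_le_sqrt (by rw [normSq_eq_quad]; linarith)
  have hC : ∀ d b, |structConst d b a| ≤ 1 := by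
    intro d b
    unfold structConst
    split_ifs <;> norm_num
  rw [force, Real.norm_eq_abs, abs_mul, abs_of_nonneg (by positivity), inv_mul_le_iff₀ (by linarith)]
  calc |∑ b, ∑ d, structConst d b a * raise g p b * p d|
      ≤ ∑ b, ∑ d : Fin 3, 1 * (√(g⁻¹ b b) * pZero g p) * ‖p‖ := by
        refine (Finset.abs_sum_le_sum_abs _ _).trans (Finset.sum_le_sum fun b _ => ?_)
        refine (Finset.abs_sum_le_sum_abs _ _).trans (Finset.sum_le_sum fun d _ => ?_)
        rw [abs_mul, abs_mul]
        gcongr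
        · exact hC d b
        · exact hr b
        · exact norm_le_pi_norm p d
    _ = pZero g p * (3 * (∑ b, √(g⁻¹ b b)) * ‖p‖) := by
        simp only [Fin.sum_univ_three]; ring

/-! ### Characteristics and transport of the distribution function -/

section Characteristics

variable {t₀ t T : ℝ} {g k : ℝ → Mat} {f : ℝ → (Fin 3 → ℝ) → ℝ} {V : ℝ → Fin 3 → ℝ}

lemma IsSolution.continuousOn_inv (h : IsSolution t₀ g k f) :
    ContinuousOn (fun s => (fun i j => (g s)⁻¹ i j : Fin 3 → Fin 3 → ℝ)) (Set.Ici t₀) :=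
  continuousOn_pi.2 fun i => continuousOn_pi.2 fun j => fun _ hs =>
    (h.hasEntryDeriv_inv hs i j).continuousWithinAt

lemma IsSolution.exists_characteristic (h : IsSolution t₀ g k f) (hT : t₀ ≤ T)
    (p : Fin 3 → ℝ) : ∃ V : ℝ → Fin 3 → ℝ, V T = p ∧ ∀ t ∈ Set.Icc t₀ T,
      HasDerivWithinAt V (force structConst (g t) (V t)) (Set.Icc t₀ T) t := by
  have hsub : Set.Icc t₀ T ⊆ Set.Ici t₀ := Set.Icc_subset_Ici_self
  have hG := h.continuousOn_inv.mono hsub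
  have hpos : ∀ t ∈ Set.Icc t₀ T, ∀ v : Fin 3 → ℝ,
      0 < 1 + ∑ i, ∑ j, (g t)⁻¹ i j * v i * v j := by
    intro t ht v
    have := quad_nonneg (h.posDef t ht.1).inv.posSemidef v
    rw [quad] at this; linarith
  have hsum : ContinuousOn (fun s => 3 * ∑ b, √((g s)⁻¹ b b)) (Set.Icc t₀ T) := by
    refine continuousOn_const.mul (continuousOn_finsetSum _ fun b _ => ContinuousOn.sqrt ?_)
    exact continuousOn_pi.1 (continuousOn_pi.1 hG b) b
  obtain ⟨κ, hκ⟩ := (isCompact_Icc.image_of_continuousOn hsum).bddAbove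
  have hκ1 : 0 < |κ| + 1 := by positivity
  obtain ⟨n, hn⟩ := exists_nat_ge ((T - t₀) / (1 / (2 * (|κ| + 1))))
  refine exists_solution_of_linear_growth (F := fun t v => force structConst (g t) v) (c := T)
    hκ1 ?_ ?_ ?_ n T ⟨hT, le_rfl⟩ ((div_le_iff₀ (by positivity)).1 hn) p
  · intro t ht v
    refine (norm_force_le (h.posDef t ht.1) v).trans ?_
    gcongr
    have := hκ ⟨t, ht, rfl⟩
    have := le_abs_self κ
    simp only at *
    linarith
  · intro R
    have hcomp : IsCompact (((fun s => (fun i j => (g s)⁻¹ i j : Fin 3 → Fin 3 → ℝ)) ''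
        Set.Icc t₀ T) ×ˢ Metric.closedBall (0 : Fin 3 → ℝ) R) :=
      (isCompact_Icc.image_of_continuousOn hG).prod (isCompact_closedBall _ _)
    have hloc : LocallyLipschitzOn (((fun s => (fun i j => (g s)⁻¹ i j : Fin 3 → Fin 3 → ℝ)) ''
        Set.Icc t₀ T) ×ˢ Metric.closedBall (0 : Fin 3 → ℝ) R) forceOfInv := by
      rintro ⟨G, v⟩ ⟨⟨t, ht, rfl⟩, -⟩
      obtain ⟨K, s, hs, hl⟩ := (contDiffAt_forceOfInv
        (x := (fun i j => (g t)⁻¹ i j, v)) (hpos t ht v)).exists_lipschitzOnWith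
      exact ⟨K, s, mem_nhdsWithin_of_mem_nhds hs, hl⟩
    obtain ⟨K, hK⟩ := hloc.exists_lipschitzOnWith_of_compact hcomp
    refine ⟨K, fun t ht v hv w hw => ?_⟩
    have := hK (x := (fun i j => (g t)⁻¹ i j, v)) ⟨⟨t, ht, rfl⟩, hv⟩
      (y := (fun i j => (g t)⁻¹ i j, w)) ⟨⟨t, ht, rfl⟩, hw⟩
    simpa only [force_eq_forceOfInv, Prod.edist_eq, edist_self, zero_le, sup_of_le_right] using this
  · intro v t ht
    have h1 := (contDiffAt_forceOfInv
      (x := (fun i j => (g t)⁻¹ i j, v)) (hpos t ht v)).continuousAt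
    exact ContinuousAt.comp_continuousWithinAt
      (f := fun s => ((fun i j => (g s)⁻¹ i j, v) : (Fin 3 → Fin 3 → ℝ) × (Fin 3 → ℝ))) h1
      ((hG t ht).prodMk continuousWithinAt_const)

/-- Links the joint derivative, one-sided in time at `t₀`, to the partial derivatives in which the
Vlasov equation is written. -/
lemma hasFDerivWithinAt_slice (ht : t₀ ≤ t) (p : Fin 3 → ℝ)
    {D : ℝ × (Fin 3 → ℝ) →L[ℝ] ℝ}
    (hD : HasFDerivWithinAt (fun x : ℝ × (Fin 3 → ℝ) => f x.1 x.2) D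
      (Set.Ici t₀ ×ˢ Set.univ) (t, p)) :
    D (1, 0) = derivWithin (fun s => f s p) (Set.Ici t₀) t ∧
      ∀ w, D (0, w) = fderiv ℝ (f t) p w := by
  constructor
  · have hγ : HasDerivWithinAt (fun s : ℝ => (s, p)) (1, 0) (Set.Ici t₀) t :=
      (hasDerivWithinAt_id _ _).prodMk (hasDerivWithinAt_const _ _ _)
    have hm : Set.MapsTo (fun s : ℝ => (s, p)) (Set.Ici t₀) (Set.Ici t₀ ×ˢ Set.univ) :=
      fun s hs => ⟨hs, trivial⟩
    have := hD.comp_hasDerivWithinAt t hγ hm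
    exact (this.derivWithin (uniqueDiffOn_Ici t₀ t ht)).symm
  · intro w
    have hγ : HasFDerivAt (fun q : Fin 3 → ℝ => (t, q))
        (ContinuousLinearMap.inr ℝ ℝ (Fin 3 → ℝ)) p := hasFDerivAt_prodMk_right t p
    have := (hD.comp p (hγ.hasFDerivWithinAt (s := Set.univ)) (fun q _ => ⟨ht, trivial⟩))
    rw [hasFDerivWithinAt_univ] at this
    rw [show f t = (fun x : ℝ × (Fin 3 → ℝ) => f x.1 x.2) ∘ fun q => (t, q) from rfl,
      this.fderiv]
    simp

lemma IsSolution.eq_along_characteristic (h : IsSolution t₀ g k f)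
    (hV : ∀ t ∈ Set.Icc t₀ T,
      HasDerivWithinAt V (force structConst (g t) (V t)) (Set.Icc t₀ T) t) :
    ∀ t ∈ Set.Icc t₀ T, f t (V t) = f t₀ (V t₀) := by
  have hd : ∀ t ∈ Set.Icc t₀ T,
      HasDerivWithinAt (fun s => f s (V s)) 0 (Set.Icc t₀ T) t := by
    intro t ht
    obtain ⟨D, hD⟩ : ∃ D, HasFDerivWithinAt (fun x : ℝ × (Fin 3 → ℝ) => f x.1 x.2) D
        (Set.Ici t₀ ×ˢ Set.univ) (t, V t) :=
      ⟨_, (h.smooth_f.differentiableOn (by simp) (t, V t) ⟨ht.1, trivial⟩).hasFDerivWithinAt⟩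
    obtain ⟨e1, e2⟩ := hasFDerivWithinAt_slice ht.1 (V t) hD
    have hγ := (hasDerivWithinAt_id t (Set.Icc t₀ T)).prodMk (hV t ht)
    have hm : Set.MapsTo (fun s => (s, V s)) (Set.Icc t₀ T) (Set.Ici t₀ ×ˢ Set.univ) :=
      fun s hs => ⟨hs.1, trivial⟩
    have h1 := hD.comp_hasDerivWithinAt t hγ hm
    refine h1.congr_deriv ?_
    have hv := h.vlasov t ht.1 (V t)
    have e3 : ((1, force structConst (g t) (V t)) : ℝ × (Fin 3 → ℝ))
        = (1, 0) + (0, force structConst (g t) (V t)) := by simp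
    rw [e3, map_add, e1, e2, ← hv]
    congr 1
    conv_lhs => rw [pi_eq_sum_univ' (force structConst (g t) (V t))]
    rw [map_sum]
    refine Finset.sum_congr rfl fun a _ => ?_
    rw [map_smul, smul_eq_mul]
  intro t ht
  refine constant_of_has_deriv_right_zero (f := fun s => f s (V s))
    (fun s hs => (hd s hs).continuousWithinAt) (fun s hs => ?_) t ht
  exact (hd s ⟨hs.1, hs.2.le⟩).mono_of_mem_nhdsWithin (Icc_mem_nhdsGE_of_mem hs)

/-- Antisymmetry of the structure constants in their lower indices: the force does no work, so the
length of a momentum changes only through the metric. -/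
lemma sum_raise_mul_force (g : Mat) (p : Fin 3 → ℝ) :
    ∑ a, raise g p a * force structConst g p a = 0 := by
  simp only [force, structConst, Fin.sum_univ_three]
  simp
  ring

lemma force_structConst (g : Mat) (p : Fin 3 → ℝ) (a : Fin 3) :
    force structConst g p a
      = (pZero g p)⁻¹ * (raise g p 0 * p a - if a = 0 then normSq g p else 0) := by
  have e : normSq g p = ∑ b, raise g p b * p b := by
    simp only [normSq, raise, Finset.sum_mul]
    exact Finset.sum_congr rfl fun b _ => Finset.sum_congr rfl fun c _ => by ring
  rw [e]
  rw [force]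
  congr 1
  fin_cases a <;> simp [structConst, Fin.sum_univ_three]
  ring

lemma IsSolution.hasDerivWithinAt_normSq (h : IsSolution t₀ g k f) {s : Set ℝ}
    (hs : s ⊆ Set.Ici t₀) (ht : t ∈ s)
    (hV : ∀ a, HasDerivWithinAt (fun τ => V τ a) (force structConst (g t) (V t) a) s t) :
    HasDerivWithinAt (fun τ => normSq (g τ) (V τ))
      (2 * quad (shearUp (g t) (k t)) (V t) - 2 * hubble (g t) (k t) * normSq (g t) (V t))
      s t := by
  have hG := fun a b => (h.hasEntryDeriv_inv (hs ht) a b).mono hs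
  have hd : HasDerivWithinAt (fun τ => normSq (g τ) (V τ)) _ s t :=
    HasDerivWithinAt.fun_sum fun a (_ : a ∈ Finset.univ) =>
      HasDerivWithinAt.fun_sum fun b (_ : b ∈ Finset.univ) =>
        ((hG a b).fun_mul (hV a)).fun_mul (hV b)
  refine hd.congr_deriv ?_
  have hi : (g t)⁻¹.IsSymm := (isSymm_of_posDef (h.posDef t (hs ht))).inv
  have e0 := sum_raise_mul_force (g t) (V t)
  have h1 := hi.apply 0 1
  have h2 := hi.apply 0 2
  have h3 := hi.apply 1 2
  simp only [Fin.sum_univ_three, raise, quad, normSq, Matrix.sub_apply, Matrix.smul_apply,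
    smul_eq_mul, h1, h2, h3] at e0 ⊢
  linear_combination 2 * e0

end Characteristics

/-! ### The Lyapunov inequality -/

/-- In Hubble units `y = |Σ|`, `u = Ω`, and `s`, `z`, `w` stand for the normalized trace of the
stress, the shear component along the distinguished direction, and the shear–stress contraction. The
left side is the derivative of `y² + 7u²` in the time `dτ = H dt`. The shear part is at most `3u²`,
while `u` decays at rate at least `73/100`, contributing `-14 · (73/100) u²`. -/
lemma lyapunov_rate_nonpos {y u s z w : ℝ} (hy : 0 ≤ y) (hs : 0 ≤ s) (hsu : s ≤ u)
    (hz : |z| ≤ u / 100) (hw : |w| ≤ y * s) (hL : y ^ 2 + 7 * u ^ 2 ≤ 1 / 16) :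
    (-4 + 2 * (y ^ 2 / 3 + (u + s) / 2)) * y ^ 2 - 6 * w
      + 14 * u * (-2 * z - 2 * (y ^ 2 / 3 + (u + s) / 2) * (1 - u - y ^ 2 / 6)
        - (-4 + 2 * (y ^ 2 / 3 + (u + s) / 2)) * y ^ 2 / 6 + w) ≤ 0 := by
  have hu : 0 ≤ u := hs.trans hsu
  have hy4 : y ≤ 1 / 4 := by nlinarith
  -- The weight `7` is large enough to force this: `7u² ≤ 1/16`.
  have hu10 : u ≤ 1 / 10 := by nlinarith
  have hy2 : y ^ 2 ≤ 1 / 16 := by nlinarith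
  obtain ⟨hz1, hz2⟩ := abs_le.1 hz
  obtain ⟨hw1, hw2⟩ := abs_le.1 hw
  -- The deceleration parameter: `H' = -(1 + q) H²`.
  set q := y ^ 2 / 3 + (u + s) / 2 with hq
  have hq8 : q ≤ 1 / 8 := by rw [hq]; linarith
  have hys : y * s ≤ y * u := by gcongr
  have hys' : y * s ≤ s / 4 := by nlinarith
  have hqu : q * u ≤ u / 8 := by nlinarith
  have hA : (-4 + 2 * q) * y ^ 2 - 6 * w ≤ 3 * u ^ 2 := by
    nlinarith [sq_nonneg (y - u), mul_nonneg (sub_nonneg.2 hq8) (sq_nonneg y)]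
  have hB : -2 * z - 2 * q * (1 - u - y ^ 2 / 6) - (-4 + 2 * q) * y ^ 2 / 6 + w
      ≤ -(73 / 100) * u := by
    have e : -2 * z - 2 * q * (1 - u - y ^ 2 / 6) - (-4 + 2 * q) * y ^ 2 / 6 + w
        = -(u + s) + 2 * (q * u) - 2 * z + w := by
      rw [hq]; ring
    rw [e]; linarith
  nlinarith [mul_le_mul_of_nonneg_left hB hu]

/-- Squared distance to the Milne solution: `|Σ|² + 7 Ω²`, where `Ω = 1 - A - |Σ|² / 6`. -/
noncomputable def lyapunov (H Q a : ℝ) : ℝ :=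
  Q / H ^ 2 + 7 * (1 - a / H ^ 2 - Q / H ^ 2 / 6) ^ 2

lemma exists_hasDerivWithinAt_lyapunov {H Q a : ℝ → ℝ} {S : Set ℝ} {t r s w z : ℝ}
    (hH : HasDerivWithinAt H (-H t ^ 2 - Q t / 3 - (r + s) / 2) S t)
    (hQ : HasDerivWithinAt Q (-6 * H t * Q t - 6 * w) S t)
    (ha : HasDerivWithinAt a (2 * z - 2 * H t * a t) S t)
    (hH0 : 0 < H t) (hQ0 : 0 ≤ Q t) (hr : r = H t ^ 2 - a t - Q t / 6)
    (hs : 0 ≤ s) (hsr : s ≤ r) (hw : |w| ≤ √(Q t) * s) (hz : |z| ≤ √(a t) * (1 / 100) * r)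
    (hL : lyapunov (H t) (Q t) (a t) ≤ 1 / 16) :
    ∃ L' ≤ 0, HasDerivWithinAt (fun τ => lyapunov (H τ) (Q τ) (a τ)) L' S t := by
  have hH2 : HasDerivWithinAt (fun τ => H τ ^ 2) _ S t := hH.fun_pow 2
  have hne : H t ^ 2 ≠ 0 := by positivity
  have hx := hQ.fun_div hH2 hne
  have hα := ha.fun_div hH2 hne
  have hd := hx.fun_add (((((hasDerivWithinAt_const t S (1 : ℝ)).fun_sub hα).fun_sub
    (hx.div_const 6)).fun_pow 2).const_mul 7)
  refine ⟨_, ?_, hd⟩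
  have hr0 : 0 ≤ r := hs.trans hsr
  have e1 : 1 - a t / H t ^ 2 - Q t / H t ^ 2 / 6 = r / H t ^ 2 := by
    rw [hr]; field_simp
  -- The Hamiltonian constraint gives `A ≤ 1`, because energy and `|Σ|²` are nonnegative.
  have haH : √(a t) ≤ H t := Real.sqrt_le_iff.2 ⟨hH0.le, by linarith⟩
  have hrate := lyapunov_rate_nonpos (y := √(Q t) / H t) (u := r / H t ^ 2) (s := s / H t ^ 2)
    (z := z / H t ^ 3) (w := w / H t ^ 3) (by positivity) (by positivity) (by gcongr)
    (by
      rw [abs_div, abs_of_pos (pow_pos hH0 3), div_le_iff₀ (by positivity)]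
      calc |z| ≤ √(a t) * (1 / 100) * r := hz
        _ ≤ H t * (1 / 100) * r := by gcongr
        _ = _ := by field_simp)
    (by
      rw [abs_div, abs_of_pos (pow_pos hH0 3), div_le_iff₀ (by positivity)]
      refine hw.trans_eq ?_
      field_simp)
    (by
      rw [lyapunov, e1] at hL
      rwa [div_pow, Real.sq_sqrt hQ0])
  have h2 := mul_nonpos_of_nonneg_of_nonpos hH0.le hrate
  refine le_of_eq_of_le ?_ h2
  rw [div_pow, Real.sq_sqrt hQ0]
  have e2 : a t = H t ^ 2 - r - Q t / 6 := by linarith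
  simp only [e2, Nat.reduceSub, pow_one, Nat.cast_ofNat]
  field_simp
  ring

/-! ### Bootstrap and bounds on momenta -/

section Dynamics

variable {t₀ t T : ℝ} {g k : ℝ → Mat} {f : ℝ → (Fin 3 → ℝ) → ℝ} {V : ℝ → Fin 3 → ℝ}

/-- The Lyapunov function of the slice of constant time. -/
noncomputable def milneDist (g k : Mat) : ℝ := lyapunov (hubble g k) (shearSq g k) (g⁻¹ 0 0)

lemma IsSolution.continuous_slice (h : IsSolution t₀ g k f) (ht : t₀ ≤ t) : Continuous (f t) := by
  rw [← continuousOn_univ]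
  exact h.smooth_f.continuousOn.comp (f := fun p => (t, p)) (by fun_prop)
    fun p _ => ⟨ht, trivial⟩

lemma IsSolution.shearSq_nonneg (h : IsSolution t₀ g k f) (ht : t₀ ≤ t) :
    0 ≤ shearSq (g t) (k t) :=
  trace_sq_nonneg (h.posDef t ht).inv.posSemidef
    (shear_isSymm (isSymm_of_posDef (h.posDef t ht)) (h.k_isSymm ht))

lemma IsSolution.sqrt_shearSq_le (h : IsSolution t₀ g k f) (ht : t₀ ≤ t)
    (hL : milneDist (g t) (k t) ≤ 1 / 16) :
    √(shearSq (g t) (k t)) ≤ hubble (g t) (k t) / 4 := by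
  have hH := h.hubble_pos ht
  rw [milneDist, lyapunov] at hL
  have h1 : shearSq (g t) (k t) / hubble (g t) (k t) ^ 2 ≤ 1 / 16 :=
    le_trans (le_add_of_nonneg_right (by positivity)) hL
  rw [div_le_iff₀ (by positivity)] at h1
  exact Real.sqrt_le_iff.2 ⟨by positivity, by nlinarith⟩

lemma IsSolution.quad_shearUp_le (h : IsSolution t₀ g k f) (ht : t₀ ≤ t)
    (hL : milneDist (g t) (k t) ≤ 1 / 16) (p : Fin 3 → ℝ) :
    quad (shearUp (g t) (k t)) p ≤ hubble (g t) (k t) / 4 * normSq (g t) p := by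
  have hg := (h.posDef t ht).inv.posSemidef
  have h1 := abs_quad_raised_le hg
    (shear_isSymm (isSymm_of_posDef (h.posDef t ht)) (h.k_isSymm ht)) p
  refine (le_abs_self _).trans (h1.trans ?_)
  rw [normSq_eq_quad]
  exact mul_le_mul_of_nonneg_right (h.sqrt_shearSq_le ht hL) (quad_nonneg hg p)

lemma quad_single (M : Mat) : quad M (Pi.single 0 1) = M 0 0 := by
  simp [quad, Fin.sum_univ_three]

/-- Expansion contributes `-2H |V|²` and shear at most `(H/2) |V|²`, because `|Σ| ≤ 1/4`. -/
lemma IsSolution.normSq_le_of_characteristic (h : IsSolution t₀ g k f)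
    (hL : ∀ t ∈ Set.Icc t₀ T, milneDist (g t) (k t) ≤ 1 / 16) (hT : t₀ ≤ T)
    (hV : ∀ t ∈ Set.Icc t₀ T,
      HasDerivWithinAt V (force structConst (g t) (V t)) (Set.Icc t₀ T) t) :
    normSq (g T) (V T) ≤ normSq (g t₀) (V t₀) := by
  have hd := fun t (ht : t ∈ Set.Icc t₀ T) =>
    h.hasDerivWithinAt_normSq Set.Icc_subset_Ici_self ht (hasDerivWithinAt_pi.1 (hV t ht))
  refine antitoneOn_of_hasDerivWithinAt_nonpos (convex_Icc t₀ T)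
    (fun t ht => (hd t ht).continuousWithinAt)
    (fun t ht => (hd t (interior_subset ht)).mono interior_subset) (fun t ht => ?_)
    ⟨le_rfl, hT⟩ ⟨hT, le_rfl⟩ hT
  have ht' := interior_subset ht
  have h1 := h.quad_shearUp_le ht'.1 (hL t ht') (V t)
  have h2 := h.hubble_pos ht'.1
  have h3 : 0 ≤ normSq (g t) (V t) := quad_nonneg (h.posDef t ht'.1).inv.posSemidef _
  nlinarith [mul_nonneg h2.le h3]

lemma IsSolution.normSq_le_of_ne_zero (h : IsSolution t₀ g k f) {d : ℝ}
    (hd : ∀ p, f t₀ p ≠ 0 → normSq (g t₀) p ≤ d)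
    (hL : ∀ t ∈ Set.Icc t₀ T, milneDist (g t) (k t) ≤ 1 / 16) (hT : t₀ ≤ T)
    {p : Fin 3 → ℝ} (hp : f T p ≠ 0) : normSq (g T) p ≤ d := by
  obtain ⟨V, rfl, hV⟩ := h.exists_characteristic hT p
  refine (h.normSq_le_of_characteristic hL hT hV).trans (hd _ ?_)
  rwa [← h.eq_along_characteristic hV T ⟨hT, le_rfl⟩]

lemma IsSolution.exists_hasDerivWithinAt_milneDist (h : IsSolution t₀ g k f) (ht : t₀ ≤ t)
    (hf : ∀ p, f t p ≠ 0 → normSq (g t) p ≤ (1 / 100) ^ 2)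
    (hL : milneDist (g t) (k t) ≤ 1 / 16) :
    ∃ L' ≤ 0, HasDerivWithinAt (fun τ => milneDist (g τ) (k τ)) L' (Set.Ici t₀) t := by
  have hg := h.posDef t ht
  have hc := h.continuous_slice ht
  have hcs := h.f_compact t ht
  have hf0 := h.f_nonneg t ht
  have hk := shear_isSymm (isSymm_of_posDef hg) (h.k_isSymm ht)
  have hπ := Real.pi_pos
  refine exists_hasDerivWithinAt_lyapunov
    (r := 8 * Real.pi / 3 * energyDensity (g t) (f t))
    (s := 8 * Real.pi / 3 * trg (g t) (stress (g t) (f t)))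
    (w := 8 * Real.pi / 3 * ∑ a, ∑ b, shearUp (g t) (k t) a b * stress (g t) (f t) a b)
    (z := shearUp (g t) (k t) 0 0)
    ((h.hasDerivWithinAt_hubble ht).congr_deriv (by ring))
    ((h.hasDerivWithinAt_shearSq ht).congr_deriv (by ring))
    ((h.hasEntryDeriv_inv ht 0 0).congr_deriv (by simp))
    (h.hubble_pos ht) (h.shearSq_nonneg ht)
    (by linear_combination (-1 / 6) * h.hamiltonian_eq ht)
    (mul_nonneg (by positivity) (trg_stress_nonneg hg hc hcs hf0))
    (mul_le_mul_of_nonneg_left (trg_stress_le hg hc hcs hf0) (by positivity)) ?_ ?_ hL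
  · rw [abs_mul, abs_of_pos (by positivity : 0 < 8 * Real.pi / 3), mul_left_comm]
    exact mul_le_mul_of_nonneg_left (abs_sum_raised_mul_stress_le hg hc hcs hf0 hk)
      (by positivity)
  · have e : shearUp (g t) (k t) 0 0
        = -(8 * Real.pi / 3) * ∑ b, (g t)⁻¹ 0 b * current (g t) (f t) b := by
      linear_combination (1 / 3) * h.momentum_eq ht
    rw [e, abs_mul, abs_neg, abs_of_pos (by positivity : 0 < 8 * Real.pi / 3), mul_left_comm]
    exact mul_le_mul_of_nonneg_left
      (abs_raise_current_le hg hc hcs hf0 (by norm_num) hf) (by positivity)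

lemma IsSolution.continuousOn_milneDist (h : IsSolution t₀ g k f) :
    ContinuousOn (fun τ => milneDist (g τ) (k τ)) (Set.Ici t₀) := by
  have hH : ContinuousOn (fun τ => hubble (g τ) (k τ)) (Set.Ici t₀) :=
    fun s hs => (h.hasDerivWithinAt_hubble hs).continuousWithinAt
  have hQ : ContinuousOn (fun τ => shearSq (g τ) (k τ)) (Set.Ici t₀) :=
    fun s hs => (h.hasDerivWithinAt_shearSq hs).continuousWithinAt
  have ha : ContinuousOn (fun τ => (g τ)⁻¹ 0 0) (Set.Ici t₀) :=
    fun s hs => (h.hasEntryDeriv_inv hs 0 0).continuousWithinAt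
  have hne : ∀ s ∈ Set.Ici t₀, hubble (g s) (k s) ^ 2 ≠ 0 :=
    fun s hs => (pow_pos (h.hubble_pos hs) 2).ne'
  unfold milneDist lyapunov
  have hQH := hQ.div (hH.pow 2) hne
  exact hQH.add (continuousOn_const.mul (((continuousOn_const.sub
    (ha.div (hH.pow 2) hne)).sub (hQH.div_const 6)).pow 2))

/-- Continuity argument. As long as the bound holds, momenta stay small and the distance does not
increase, so it keeps its strict initial bound; continuity then carries the weak bound a little
further. -/
lemma IsSolution.milneDist_le (h : IsSolution t₀ g k f)
    (hf : ∀ p, f t₀ p ≠ 0 → normSq (g t₀) p ≤ (1 / 100) ^ 2)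
    (hL : milneDist (g t₀) (k t₀) < 1 / 16) (ht : t₀ ≤ t) :
    milneDist (g t) (k t) ≤ 1 / 16 := by
  have hc := h.continuousOn_milneDist
  have hstep : ∀ T, t₀ ≤ T → (∀ s ∈ Set.Icc t₀ T, milneDist (g s) (k s) ≤ 1 / 16) →
      milneDist (g T) (k T) ≤ milneDist (g t₀) (k t₀) := by
    intro T hT hs
    have hd := fun s (hsT : s ∈ Set.Icc t₀ T) =>
      h.exists_hasDerivWithinAt_milneDist hsT.1
        (fun p hp => h.normSq_le_of_ne_zero hf
          (fun τ hτ => hs τ ⟨hτ.1, hτ.2.trans hsT.2⟩) hsT.1 hp) (hs s hsT)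
    choose! L' hL' hD using hd
    refine antitoneOn_of_hasDerivWithinAt_nonpos (convex_Icc t₀ T)
      (hc.mono Set.Icc_subset_Ici_self)
      (fun s hsT => (hD s (interior_subset hsT)).mono
        (interior_subset.trans Set.Icc_subset_Ici_self))
      (fun s hsT => hL' s (interior_subset hsT)) ⟨le_rfl, hT⟩ ⟨hT, le_rfl⟩ hT
  have hclosed : IsClosed ({s | milneDist (g s) (k s) ≤ 1 / 16} ∩ Set.Icc t₀ t) := by
    rw [Set.inter_comm]
    exact (hc.mono Set.Icc_subset_Ici_self).preimage_isClosed_of_isClosed isClosed_Icc isClosed_Iic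
  refine hclosed.Icc_subset_of_forall_mem_nhdsGT_of_Icc_subset hL.le (fun s hs hsub => ?_)
    ⟨ht, le_rfl⟩
  have h1 : milneDist (g s) (k s) < 1 / 16 := (hstep s hs.1 hsub).trans_lt hL
  have h2 := (hc s hs.1).eventually (gt_mem_nhds h1)
  refine Filter.mem_of_superset (nhdsWithin_mono s (Set.Ioi_subset_Ici hs.1) h2) ?_
  exact fun τ (hτ : milneDist (g τ) (k τ) < 1 / 16) => hτ.le

/-- Here `|p^0-component raised|`, that is `|raise g p 0|`, is at most `√(g⁻¹ 0 0) |p|`, hence at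
most half of `|p|² + g⁻¹ 0 0`. The extra term in the distinguished direction is absorbed by `-2x ≤ 1
+ x²`, which is why `1 + p_a²` is estimated instead of `p_a²`. -/
lemma two_mul_force_le {g : Mat} (hg : g.PosDef) (p : Fin 3 → ℝ) (a : Fin 3) :
    2 * p a * force structConst g p a ≤ 2 * (normSq g p + g⁻¹ 0 0) * (1 + p a ^ 2) := by
  have hG := hg.inv.posSemidef
  have h0 := one_le_pZero hg p
  have hn : 0 ≤ normSq g p := quad_nonneg hG p
  have hG0 : 0 ≤ g⁻¹ 0 0 := hG.diag_nonneg
  have hr : |raise g p 0| ≤ (normSq g p + g⁻¹ 0 0) / 2 := by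
    refine (abs_mulVec_le hG p 0).trans ?_
    have h1 := Real.sq_sqrt hG0
    have h2 := Real.sq_sqrt (show 0 ≤ quad g⁻¹ p from hn)
    rw [normSq_eq_quad]
    nlinarith [sq_nonneg (√(g⁻¹ 0 0) - √(quad g⁻¹ p))]
  have hδ : -(2 * p a * if a = 0 then normSq g p else 0) ≤ normSq g p * (1 + p a ^ 2) := by
    split_ifs
    · nlinarith [mul_nonneg hn (sq_nonneg (p a + 1))]
    · simpa using by positivity
  have hb : 2 * p a * (raise g p 0 * p a - if a = 0 then normSq g p else 0)
      ≤ 2 * (normSq g p + g⁻¹ 0 0) * (1 + p a ^ 2) := by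
    have := mul_le_mul_of_nonneg_right ((le_abs_self _).trans hr) (sq_nonneg (p a))
    nlinarith [mul_nonneg hG0 (sq_nonneg (p a))]
  rw [force_structConst, mul_left_comm, inv_mul_le_iff₀ (by linarith)]
  refine hb.trans (le_mul_of_one_le_left (by positivity) h0)

lemma IsSolution.neg_deriv_hubble_le (h : IsSolution t₀ g k f) (ht : t₀ ≤ t)
    (hL : milneDist (g t) (k t) ≤ 1 / 16) :
    shearSq (g t) (k t) / 3
        + 4 * Real.pi / 3 * (energyDensity (g t) (f t) + trg (g t) (stress (g t) (f t)))
      ≤ hubble (g t) (k t) ^ 2 / 8 := by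
  have hH := h.hubble_pos ht
  have hQ := h.shearSq_nonneg ht
  have h1 := h.hamiltonian_eq ht
  have h2 := trg_stress_le (h.posDef t ht) (h.continuous_slice ht) (h.f_compact t ht)
    (h.f_nonneg t ht)
  have h3 := mul_le_mul_of_nonneg_left h2 (show 0 ≤ 4 * Real.pi / 3 by positivity)
  set H := hubble (g t) (k t)
  set Q := shearSq (g t) (k t)
  set ρ := energyDensity (g t) (f t)
  have e : 1 - (g t)⁻¹ 0 0 / H ^ 2 - Q / H ^ 2 / 6 = 8 * Real.pi / 3 * ρ / H ^ 2 := by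
    field_simp
    linarith
  rw [milneDist, lyapunov, e] at hL
  have hx : Q = Q / H ^ 2 * H ^ 2 := by field_simp
  have hu : 8 * Real.pi / 3 * ρ = 8 * Real.pi / 3 * ρ / H ^ 2 * H ^ 2 := by field_simp
  have hx0 : 0 ≤ Q / H ^ 2 := by positivity
  set x := Q / H ^ 2
  set u := 8 * Real.pi / 3 * ρ / H ^ 2
  have hx1 : x ≤ 1 / 16 := by nlinarith [sq_nonneg u]
  have hu1 : u ≤ 1 / 10 := by nlinarith
  have hxu : x / 3 + u ≤ 1 / 8 := by linarith
  nlinarith [mul_le_mul_of_nonneg_right hxu (sq_nonneg H)]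

lemma IsSolution.one_add_sq_le (h : IsSolution t₀ g k f)
    (hL : ∀ t, t₀ ≤ t → milneDist (g t) (k t) ≤ 1 / 16) (hT : t₀ ≤ T)
    (hV : ∀ t ∈ Set.Icc t₀ T,
      HasDerivWithinAt V (force structConst (g t) (V t)) (Set.Icc t₀ T) t) (a : Fin 3) :
    1 + V T a ^ 2 ≤ (1 + V t₀ a ^ 2) * Real.exp
      (6 * ((normSq (g t₀) (V t₀) + (g t₀)⁻¹ 0 0) / hubble (g t₀) (k t₀))) := by
  -- Division by `H` costs at most a rate `(9/8) H` against the decay rate `(3/2) H` of the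
  -- numerator, so `W' ≤ -(3/8)(|V|² + g⁻¹ 0 0)`. The factor `6` suffices because `6 · 3/8 ≥ 2`.
  set W : ℝ → ℝ := fun t => (normSq (g t) (V t) + (g t)⁻¹ 0 0) / hubble (g t) (k t) with hW
  have hd : ∀ t ∈ Set.Icc t₀ T, ∃ D ≤ 0,
      HasDerivWithinAt (fun s => (1 + V s a ^ 2) * Real.exp (6 * W s)) D (Set.Icc t₀ T) t := by
    intro t ht
    have hsub : Set.Icc t₀ T ⊆ Set.Ici t₀ := Set.Icc_subset_Ici_self
    have hVt := hasDerivWithinAt_pi.1 (hV t ht)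
    have hH := h.hubble_pos ht.1
    have hG := (h.posDef t ht.1).inv.posSemidef
    have hZ := (h.hasDerivWithinAt_normSq hsub ht hVt).fun_add
      ((h.hasEntryDeriv_inv ht.1 0 0).mono hsub)
    have hWd := hZ.fun_div ((h.hasDerivWithinAt_hubble ht.1).mono hsub) hH.ne'
    have hD := (((hVt a).fun_pow 2).const_add 1).fun_mul ((hWd.const_mul 6).exp)
    refine ⟨_, ?_, hD⟩
    have hF := two_mul_force_le (h.posDef t ht.1) (V t) a
    have hq := h.neg_deriv_hubble_le ht.1 (hL t ht.1)
    have hn := h.quad_shearUp_le ht.1 (hL t ht.1) (V t)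
    have he := h.quad_shearUp_le ht.1 (hL t ht.1) (Pi.single 0 1)
    rw [normSq_eq_quad (g t) (Pi.single 0 1), quad_single, quad_single] at he
    have hn0 : 0 ≤ normSq (g t) (V t) := quad_nonneg hG _
    have hG0 : 0 ≤ (g t)⁻¹ 0 0 := hG.diag_nonneg
    simp only [Matrix.sub_apply, Matrix.smul_apply, smul_eq_mul]
    set H := hubble (g t) (k t)
    set n := normSq (g t) (V t)
    set G0 := (g t)⁻¹ 0 0
    set q := shearSq (g t) (k t) / 3
        + 4 * Real.pi / 3 * (energyDensity (g t) (f t) + trg (g t) (stress (g t) (f t))) with hqd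
    set E := Real.exp (6 * ((n + G0) / H))
    have hE : 0 < E := Real.exp_pos _
    have hWle : ((2 * quad (shearUp (g t) (k t)) (V t) - 2 * H * n
          + (2 * shearUp (g t) (k t) 0 0 - 2 * H * G0)) * H
        - (n + G0) * (-H ^ 2 - shearSq (g t) (k t) / 3
          - 4 * Real.pi / 3 * (energyDensity (g t) (f t) + trg (g t) (stress (g t) (f t)))))
        / H ^ 2 ≤ -(3 / 8) * (n + G0) := by
      rw [div_le_iff₀ (by positivity)]
      have h1 : (2 * quad (shearUp (g t) (k t)) (V t) - 2 * H * n
          + (2 * shearUp (g t) (k t) 0 0 - 2 * H * G0)) * H ≤ -(3 / 2) * H * (n + G0) * H := by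
        gcongr; linarith
      have h2 : (n + G0) * q ≤ (n + G0) * (H ^ 2 / 8) := by gcongr
      have h3 : -H ^ 2 - shearSq (g t) (k t) / 3
          - 4 * Real.pi / 3 * (energyDensity (g t) (f t) + trg (g t) (stress (g t) (f t)))
          = -H ^ 2 - q := by rw [hqd]; ring
      rw [h3]
      linarith
    generalize ((2 * quad (shearUp (g t) (k t)) (V t) - 2 * H * n
          + (2 * shearUp (g t) (k t) 0 0 - 2 * H * G0)) * H
        - (n + G0) * (-H ^ 2 - shearSq (g t) (k t) / 3
          - 4 * Real.pi / 3 * (energyDensity (g t) (f t) + trg (g t) (stress (g t) (f t)))))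
        / H ^ 2 = W' at hWle ⊢
    have h4 : 2 * V t a * force structConst (g t) (V t) a + (1 + V t a ^ 2) * (6 * W') ≤ 0 := by
      have h5 := mul_le_mul_of_nonneg_left hWle (show 0 ≤ 6 * (1 + V t a ^ 2) by positivity)
      have h6 : 0 ≤ (n + G0) * (1 + V t a ^ 2) := by positivity
      linarith
    calc _ = (2 * V t a * force structConst (g t) (V t) a + (1 + V t a ^ 2) * (6 * W')) * E := by
          push_cast; ring
      _ ≤ 0 := mul_nonpos_of_nonpos_of_nonneg h4 hE.le
  choose! D hD0 hD using hd
  have hanti := antitoneOn_of_hasDerivWithinAt_nonpos (convex_Icc t₀ T)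
      (fun t ht => (hD t ht).continuousWithinAt)
      (fun t ht => (hD t (interior_subset ht)).mono interior_subset)
      (fun t ht => hD0 t (interior_subset ht)) ⟨le_rfl, hT⟩ ⟨hT, le_rfl⟩ hT
  simp only at hanti
  -- At the final time the exponential factor is at least `1`, since `W ≥ 0`.
  refine le_trans (le_mul_of_one_le_right (by positivity) (Real.one_le_exp ?_)) hanti
  have hG := (h.posDef T hT).inv.posSemidef
  have hn0 : 0 ≤ normSq (g T) (V T) := quad_nonneg hG _
  have hG0 : 0 ≤ (g T)⁻¹ 0 0 := hG.diag_nonneg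
  have := h.hubble_pos hT
  simp only [hW]
  positivity

lemma normSq_le_sum (g : Mat) {p : Fin 3 → ℝ} {r : ℝ} (hp : ∀ i, |p i| ≤ r) :
    normSq g p ≤ (∑ a, ∑ b, |g⁻¹ a b|) * r ^ 2 := by
  simp only [normSq, Finset.sum_mul]
  refine Finset.sum_le_sum fun a _ => Finset.sum_le_sum fun b _ => (le_abs_self _).trans ?_
  rw [abs_mul, abs_mul, mul_assoc, sq]
  have := hp a
  have := hp b
  have : 0 ≤ r := (abs_nonneg _).trans (hp a)
  gcongr

/-- A bound on the components of a characteristic whose initial components are at most `r`. -/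
noncomputable def momentumBound (g k : Mat) (r : ℝ) : ℝ :=
  (1 + r ^ 2) * Real.exp (6 * (((∑ a, ∑ b, |g⁻¹ a b|) * r ^ 2 + g⁻¹ 0 0) / hubble g k))

lemma IsSolution.abs_le_momentumBound (h : IsSolution t₀ g k f)
    (hL : ∀ t, t₀ ≤ t → milneDist (g t) (k t) ≤ 1 / 16) (hT : t₀ ≤ T)
    (hV : ∀ t ∈ Set.Icc t₀ T,
      HasDerivWithinAt V (force structConst (g t) (V t)) (Set.Icc t₀ T) t)
    {r : ℝ} (hr : ∀ i, |V t₀ i| ≤ r) (a : Fin 3) :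
    |V T a| ≤ momentumBound (g t₀) (k t₀) r := by
  have h1 := h.one_add_sq_le hL hT hV a
  have h2 := normSq_le_sum (g t₀) hr
  have h3 := h.hubble_pos le_rfl
  have h4 : V t₀ a ^ 2 ≤ r ^ 2 := sq_le_sq' (abs_le.1 (hr a)).1 (abs_le.1 (hr a)).2
  have h5 : |V T a| ≤ 1 + V T a ^ 2 := by
    rw [← sq_abs]; nlinarith [sq_nonneg (|V T a| - 1)]
  refine h5.trans (h1.trans ?_)
  rw [momentumBound]
  gcongr

end Dynamics

/-! ### Smallness of the initial data -/

section InitialData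

variable {g k : Mat}

lemma shearNormalized_eq (a b : Fin 3) :
    shearNormalized g k a b = (g⁻¹ * shear g k) a b / hubble g k := rfl

/-- Vanishing trace expresses the first diagonal entry through the other two. The off-diagonal part
is a sum of products, as a mixed tensor need not be symmetric. -/
lemma shearSq_div_eq (hg : g.PosDef) (hk : k.IsSymm) (hH : hubble g k ≠ 0) :
    shearSq g k / hubble g k ^ 2 = 6 * shearPlus g k ^ 2 + 6 * shearMinus g k ^ 2
      + 2 * (shearNormalized g k 0 1 * shearNormalized g k 1 0
        + shearNormalized g k 0 2 * shearNormalized g k 2 0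
        + shearNormalized g k 1 2 * shearNormalized g k 2 1) := by
  have htr : (g⁻¹ * shear g k).trace = 0 := by
    rw [inv_mul_shear hg, Matrix.trace_add, trace_inv_mul hk, Matrix.trace_smul, Matrix.trace_one]
    simp
    ring
  have h3 : √(3 : ℝ) ^ 2 = 3 := Real.sq_sqrt (by norm_num)
  have e0 : shearNormalized g k 0 0
      = -(shearNormalized g k 1 1 + shearNormalized g k 2 2) := by
    simp only [Matrix.trace, Matrix.diag, Fin.sum_univ_three] at htr
    simp only [shearNormalized_eq]
    rw [← add_div, ← neg_div]
    congr 1; linarith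
  have e1 : shearSq g k / hubble g k ^ 2
      = ∑ a, ∑ b, shearNormalized g k a b * shearNormalized g k b a := by
    simp only [shearSq, Matrix.trace, Matrix.diag, Matrix.mul_apply (M := g⁻¹ * shear g k),
      shearNormalized_eq, Finset.sum_div]
    exact Finset.sum_congr rfl fun a _ => Finset.sum_congr rfl fun b _ => by
      field_simp
  have e2 : shearMinus g k ^ 2
      = (shearNormalized g k 1 1 - shearNormalized g k 2 2) ^ 2 / 12 := by
    rw [shearMinus, mul_pow, neg_sq, div_pow, mul_pow, h3]; ring
  rw [e1, e2, shearPlus]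
  simp only [Fin.sum_univ_three, e0]
  ring

lemma SmallData.normSq_le {f : (Fin 3 → ℝ) → ℝ} {δ : ℝ} (hs : SmallData δ g k f)
    (hg : g.PosDef) (hc : HasCompactSupport f) {p : Fin 3 → ℝ} (hp : f p ≠ 0) :
    normSq g p ≤ δ ^ 2 := by
  -- Compact support is needed here: `sSup` of an unbounded set would bound nothing.
  have hb : BddAbove ((fun p => √(normSq g p)) '' {p | f p ≠ 0}) :=
    (hc.isCompact.image (continuous_normSq g).sqrt).bddAbove.mono
      (Set.image_mono (subset_tsupport f))
  have h1 : √(normSq g p) ≤ δ := (le_csSup hb ⟨p, hp, rfl⟩).trans hs.momentum.le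
  have h2 := Real.sq_sqrt (quad_nonneg hg.inv.posSemidef p)
  rw [normSq_eq_quad] at *
  rw [← h2]
  gcongr

end InitialData

lemma IsSolution.milneDist_lt {t₀ : ℝ} {g k : ℝ → Mat} {f : ℝ → (Fin 3 → ℝ) → ℝ}
    (h : IsSolution t₀ g k f) (hs : SmallData (1 / 100) (g t₀) (k t₀) (f t₀)) :
    milneDist (g t₀) (k t₀) < 1 / 16 := by
  have hg := h.posDef t₀ le_rfl
  have hH := h.hubble_pos le_rfl
  have hx := shearSq_div_eq hg (h.k_isSymm le_rfl) hH.ne'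
  have hQ := h.shearSq_nonneg le_rfl
  have hρ : 0 ≤ energyDensity (g t₀) (f t₀) := energyDensity_nonneg (h.f_nonneg t₀ le_rfl)
  have hham := h.hamiltonian_eq le_rfl
  have hA : curvA (g t₀) (k t₀) = (g t₀)⁻¹ 0 0 / hubble (g t₀) (k t₀) ^ 2 := by
    rw [curvA, scalarCurv_structConst (isSymm_of_posDef hg) (inv_mul_of_posDef hg)]
    field_simp
  have hA1 := abs_le.1 hs.curv.le
  rw [hA] at hA1
  have hp := sq_le_sq' (abs_le.1 hs.plus.le).1 (abs_le.1 hs.plus.le).2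
  have hm := sq_le_sq' (abs_le.1 hs.minus.le).1 (abs_le.1 hs.minus.le).2
  have hoff : ∀ i j, i ≠ j → shearNormalized (g t₀) (k t₀) i j * shearNormalized (g t₀) (k t₀) j i
      ≤ (1 / 100) ^ 2 := by
    intro i j hij
    refine (le_abs_self _).trans ?_
    rw [abs_mul, sq]
    exact mul_le_mul (hs.offDiag i j hij).le (hs.offDiag j i hij.symm).le (abs_nonneg _)
      (by norm_num)
  have h01 := hoff 0 1 (by decide)
  have h02 := hoff 0 2 (by decide)
  have h12 := hoff 1 2 (by decide)
  have hx0 : 0 ≤ shearSq (g t₀) (k t₀) / hubble (g t₀) (k t₀) ^ 2 := by positivity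
  have hu0 : 0 ≤ 1 - (g t₀)⁻¹ 0 0 / hubble (g t₀) (k t₀) ^ 2
      - shearSq (g t₀) (k t₀) / hubble (g t₀) (k t₀) ^ 2 / 6 := by
    have e : 1 - (g t₀)⁻¹ 0 0 / hubble (g t₀) (k t₀) ^ 2
      - shearSq (g t₀) (k t₀) / hubble (g t₀) (k t₀) ^ 2 / 6
      = 16 * Real.pi * energyDensity (g t₀) (f t₀) / 6 / hubble (g t₀) (k t₀) ^ 2 := by
      rw [← hham]; field_simp
    rw [e]; positivity
  -- `18 = 6 + 6 + 2 · 3`, the coefficients in `shearSq_div_eq`, times `δ² = 1/10000`.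
  have hx1 : shearSq (g t₀) (k t₀) / hubble (g t₀) (k t₀) ^ 2 ≤ 18 / 10000 := by
    rw [hx]; linarith
  rw [milneDist, lyapunov]
  nlinarith

end BianchiV

theorem mainTheorem5 :
    ∃ δ : ℝ, 0 < δ ∧
      ∀ (t₀ : ℝ) (g k : ℝ → Matrix (Fin 3) (Fin 3) ℝ) (f : ℝ → (Fin 3 → ℝ) → ℝ),
        BianchiV.IsSolution t₀ g k f →
        BianchiV.SmallData δ (g t₀) (k t₀) (f t₀) →
        (∀ r : ℝ, ∃ C M : ℝ, ∀ V : ℝ → Fin 3 → ℝ,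
            BianchiV.IsCharacteristic t₀ g V → (∀ i, |V t₀ i| ≤ r) →
            ∀ t, t₀ ≤ t → ∀ i, |V t i| ≤ C + M * t⁻¹) ∧
        (∃ C : ℝ, ∀ t, t₀ ≤ t → ∀ p : Fin 3 → ℝ, (∃ i, C ≤ |p i|) → f t p = 0) := by
  refine ⟨1 / 100, by norm_num, fun t₀ g k f h hs => ?_⟩
  have hf : ∀ p, f t₀ p ≠ 0 → BianchiV.normSq (g t₀) p ≤ (1 / 100) ^ 2 :=
    fun p hp => hs.normSq_le (h.posDef t₀ le_rfl) (h.f_compact t₀ le_rfl) hp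
  have hL : ∀ t, t₀ ≤ t → BianchiV.milneDist (g t) (k t) ≤ 1 / 16 :=
    fun t ht => h.milneDist_le hf (h.milneDist_lt hs) ht
  -- The bound is uniform in time, so `M = 0` serves.
  refine ⟨fun r => ⟨BianchiV.momentumBound (g t₀) (k t₀) r, 0, fun V hV hr t ht i => ?_⟩, ?_⟩
  · rw [zero_mul, add_zero]
    refine h.abs_le_momentumBound hL ht (fun s hs' => hasDerivWithinAt_pi.2 fun a => ?_) hr i
    exact (hV s hs'.1 a).mono Set.Icc_subset_Ici_self
  · obtain ⟨R, hR⟩ := (h.f_compact t₀ le_rfl).isCompact.isBounded.exists_norm_le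
    -- The `+ 1` makes the inequality strict, as required for the closed condition `C ≤ |p i|`.
    refine ⟨BianchiV.momentumBound (g t₀) (k t₀) R + 1, fun t ht p ⟨i, hi⟩ => ?_⟩
    by_contra hp
    obtain ⟨V, rfl, hV⟩ := h.exists_characteristic ht p
    have h0 : f t₀ (V t₀) ≠ 0 := by
      rwa [← h.eq_along_characteristic hV t ⟨ht, le_rfl⟩]
    have hb := h.abs_le_momentumBound hL ht hV (r := R)
      (fun j => (norm_le_pi_norm (V t₀) j).trans (hR _ (subset_tsupport _ h0))) i
    linarith
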